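/- Let $\alpha\in(0,1)$, $\Omega=(0,1)$, $a\in C^2(\overline\Omega)$ with $a\ge a_0>0$ on $\overline\Omega$ for some constant $a_0$, and $q\in L^\infty(\Omega)$ with $q\ge 0$ almost everywhere. Let $A$ be the operator in $L^2(\Omega)$ given by $Av=-(av')'+qv$ with domain $D(A)=\{v\in L^2(\Omega): (av')'-qv\in L^2(\Omega),\ v'(0)=v(1)=0\}$. Let $\{(\lambda_n,\varphi_n)\}_{n=1}^\infty$ be the eigenpairs of $A$: $\lambda_1<\lambda_2<\cdots$ are all the eigenvalues of $A$, and $\varphi_n$ is a real eigenfunction for $\lambda_n$ with $\|\varphi_n\|_{L^2(\Omega)}=1$. Write $(\cdot,\cdot)$ for the inner product of $L^2(\Omega)$ and $$E_{\alpha,\beta}(z)=\sum_{k=0}^\infty\frac{z^k}{\Gamma(k\alpha+\beta)},\qquad z\in\mathbb C .$$ Let $u_0,f\in L^2(\Omega)$ be real-valued, put $\rho_n=\big[(u_0,\varphi_n)-\lambda_n^{-1}(f,\varphi_n)\big]\varphi_n(0)$ for $n\ge1$, and for $t>0$ define $$h_1(t)=\sum_{n=1}^\infty\rho_nE_{\alpha,1}(-\lambda_nt^\alpha),\qquad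 h_2(t)=\sum_{n=1}^\infty\varphi_n(0)^2\,t^{\alpha-1}E_{\alpha,\alpha}(-\lambda_nt^\alpha).$$ Then both series converge absolutely for every $t>0$, and the following statements hold. (i) $h_1$ and $h_2$ are real-analytic on $(0,\infty)$. (ii) For every $z\in\mathbb C$ with $\operatorname{Re} z>0$, the functions $t\mapsto e^{-zt}h_j(t)$, $j=1,2$, are integrable on $(0,\infty)$, and the Laplace transforms $\mathcal L[h_j](z)=\int_0^\infty e^{-zt}h_j(t)\,dt$ are given by the absolutely convergent series $$\mathcal L[h_1](z)=\sum_{n=1}^\infty\frac{\rho_nz^{\alpha-1}}{z^\alpha+\lambda_n},\qquad \mathcal L[h_2](z)=\sum_{n=1}^\infty\frac{\varphi_n(0)^2}{z^\alpha+\lambda_n},$$ with principal branches of the powers of $z$. -/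

import Mathlib

noncomputable section

open MeasureTheory Set

namespace Subdiffusion

/-- Lebesgue measure on the unit interval `Ω = (0, 1)`. Functions on `Ω` or on its closure are
represented by functions `ℝ → ℝ` of which only the restriction to `[0, 1]` matters. -/
def unitMeasure : Measure ℝ := volume.restrict (Ioo 0 1)

/-- The real `L²(0, 1)` inner product `(u, v)`. -/
def l2Inner (u v : ℝ → ℝ) : ℝ := ∫ x, u x * v x ∂unitMeasure

/-- Admissible coefficients of the elliptic operator: `a ∈ C²[0, 1]` with `a ≥ a₀ > 0`, and
`q ∈ L^∞(0, 1)` with `q ≥ 0` almost everywhere. -/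
structure IsAdmissible (a q : ℝ → ℝ) : Prop where
  contDiffOn : ContDiffOn ℝ 2 a (Icc 0 1)
  elliptic : ∃ a₀ : ℝ, 0 < a₀ ∧ ∀ x ∈ Icc (0 : ℝ) 1, a₀ ≤ a x
  memLp : MemLp q ⊤ unitMeasure
  nonneg : ∀ᵐ x ∂unitMeasure, 0 ≤ q x

/-- The flux `a v'` on `[0, 1]`, with one-sided derivatives at the end points. -/
def flux (a v : ℝ → ℝ) (x : ℝ) : ℝ := a x * derivWithin v (Icc 0 1) x

/-- The elliptic operator `𝒜 v = (a v')' - q v`, meaningful at almost every point of `(0, 1)` when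
the flux `a v'` is absolutely continuous. -/
def ellipticOp (a q v : ℝ → ℝ) (x : ℝ) : ℝ := deriv (flux a v) x - q x * v x

/-- The domain `D(A) = {v ∈ L² : 𝒜 v ∈ L², v'(0) = v(1) = 0}` of the realization `A` of `-𝒜`,
described through the continuously differentiable representative of `v`: for `v ∈ L²(0, 1)`, that
`𝒜 v ∈ L²(0, 1)` in the weak sense means that `v` is `C¹` on `[0, 1]` (after modification on a null
set) with absolutely continuous flux, and that `(a v')' - q v`, computed almost everywhere, is in
`L²(0, 1)`. -/
structure InDomain (a q v : ℝ → ℝ) : Prop where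
  contDiffOn : ContDiffOn ℝ 1 v (Icc 0 1)
  absolutelyContinuous : AbsolutelyContinuousOnInterval (flux a v) 0 1
  memLp : MemLp (ellipticOp a q v) 2 unitMeasure
  neumann : derivWithin v (Icc 0 1) 0 = 0
  dirichlet : v 1 = 0

/-- `(μ, ψ)` is an eigenpair of `A`: `0 ≠ ψ ∈ D(A)` and `-𝒜 ψ = μ ψ` in `(0, 1)`. -/
structure IsEigenpair (a q : ℝ → ℝ) (μ : ℝ) (ψ : ℝ → ℝ) : Prop where
  inDomain : InDomain a q ψ
  eigen : ∀ᵐ x ∂unitMeasure, -ellipticOp a q ψ x = μ * ψ x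
  ne_zero : ∃ x ∈ Icc (0 : ℝ) 1, ψ x ≠ 0

/-- `(lam n, φ n)`, `n = 0, 1, 2, …`, is the sequence of all eigenpairs of `A` (the customary
`(λ_{n+1}, φ_{n+1})`): the numbers `lam n` enumerate all the eigenvalues in strictly increasing
order, and `φ n` is an eigenfunction for `lam n` of unit `L²` norm. -/
structure IsEigenSystem (a q : ℝ → ℝ) (lam : ℕ → ℝ) (φ : ℕ → ℝ → ℝ) : Prop where
  strictMono : StrictMono lam
  isEigenpair : ∀ n, IsEigenpair a q (lam n) (φ n)
  exhaustive : ∀ μ ψ, IsEigenpair a q μ ψ → ∃ n, lam n = μ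
  normalized : ∀ n, l2Inner (φ n) (φ n) = 1

/-- The two-parameter Mittag-Leffler function `E_{α,β}(z) = ∑ z^k / Γ(kα + β)`. -/
def mittagLeffler (α β : ℝ) (z : ℂ) : ℂ := ∑' k : ℕ, z ^ k / (Real.Gamma (k * α + β) : ℂ)

/-- The coefficients `ρ_n = [(u₀, φ_n) - λ_n⁻¹ (f, φ_n)] φ_n(0)`. -/
def rho (lam : ℕ → ℝ) (φ : ℕ → ℝ → ℝ) (u₀ f : ℝ → ℝ) (n : ℕ) : ℝ :=
  (l2Inner u₀ (φ n) - (lam n)⁻¹ * l2Inner f (φ n)) * φ n 0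

/-- The `n`-th term `ρ_n E_{α,1}(-λ_n t^α)` of the series `h₁`. -/
def h₁Term (α : ℝ) (lam : ℕ → ℝ) (φ : ℕ → ℝ → ℝ) (u₀ f : ℝ → ℝ) (n : ℕ) (t : ℝ) : ℂ :=
  (rho lam φ u₀ f n : ℂ) * mittagLeffler α 1 ((-(lam n * t ^ α) : ℝ) : ℂ)

/-- The `n`-th term `φ_n(0)² t^{α-1} E_{α,α}(-λ_n t^α)` of the series `h₂`. -/
def h₂Term (α : ℝ) (lam : ℕ → ℝ) (φ : ℕ → ℝ → ℝ) (n : ℕ) (t : ℝ) : ℂ :=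
  ((φ n 0 ^ 2 * t ^ (α - 1) : ℝ) : ℂ) * mittagLeffler α α ((-(lam n * t ^ α) : ℝ) : ℂ)

/-- `h₁(t) = ∑ ρ_n E_{α,1}(-λ_n t^α)`. -/
def h₁ (α : ℝ) (lam : ℕ → ℝ) (φ : ℕ → ℝ → ℝ) (u₀ f : ℝ → ℝ) (t : ℝ) : ℂ :=
  ∑' n, h₁Term α lam φ u₀ f n t

/-- `h₂(t) = ∑ φ_n(0)² t^{α-1} E_{α,α}(-λ_n t^α)`. -/
def h₂ (α : ℝ) (lam : ℕ → ℝ) (φ : ℕ → ℝ → ℝ) (t : ℝ) : ℂ :=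
  ∑' n, h₂Term α lam φ n t

/-- The integrand `e^{-zt} h(t)` of the Laplace transform. -/
def laplaceIntegrand (h : ℝ → ℂ) (z : ℂ) (t : ℝ) : ℂ := Complex.exp (-z * t) * h t

/-- The Laplace transform of `h` exists at `z`: the defining integral converges absolutely. -/
def LaplaceConvergent (h : ℝ → ℂ) (z : ℂ) : Prop := IntegrableOn (laplaceIntegrand h z) (Ioi 0)

/-- The Laplace transform `ℒ[h](z) = ∫₀^∞ e^{-zt} h(t) dt`. -/
def laplace (h : ℝ → ℂ) (z : ℂ) : ℂ := ∫ t in Ioi (0 : ℝ), laplaceIntegrand h z t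

end Subdiffusion

end

/-!
The proof rests on one observation: as functions of `t`, both `E_{α,1}(-λ t ^ α)` and
`t ^ (α - 1) E_{α,α}(-λ t ^ α)` are Laplace transforms `∫ e ^ (-t r) dμ(r)` of explicit positive
measures on `(0, ∞)`, whose Stieltjes transforms `∫ dμ(r) / (z + r)` are
`z ^ (α - 1) / (z ^ α + λ)` and `1 / (z ^ α + λ)`. In the variable `x = log r` the density is, up to
a factor `λ` or `e ^ x`, the function `kern α λ x`.

For such a function `F(τ) = ∫ e ^ (-τ r) dμ(r)` everything follows from positivity and Fubini. It
is holomorphic for `Re τ > 0`; since `e ^ (-s) ≤ 1 / (1 + s)`, it is bounded for `Re τ ≥ σ` by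
`σ⁻¹ ∫ dμ(r) / (σ⁻¹ + r)`; its Laplace transform is the Stieltjes transform of `μ`, and the integral
of `|e ^ (-z t) F(t)|` is at most the Stieltjes transform at `Re z`. All these bounds are
`O(1 / λ)`, so a series with coefficients `c_n` converges, is analytic, and can be transformed
termwise as soon as `∑ |c_n| / λ_n < ∞` (`completelyMonotone_series`).

The representing measure is found by comparing Laplace transforms. The Stieltjes transform of
`kern` is computed by Cauchy's theorem in a logarithmic strip (`integral_kern_mul_stieltjes`), the
Laplace transform of the Mittag-Leffler kernel termwise for large `Re z` (`laplace_mlKernel`), and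
functions with the same Laplace transform on a vertical line agree by Fourier inversion
(`eq_of_laplace_eq`).

On the spectral side, integration by parts makes the eigenfunctions orthogonal both in `L²` and in
the energy form. Evaluation at `0` is bounded in the energy norm, so Bessel's inequality gives
`∑ φ_n(0)² / λ_n < ∞`; with Bessel's inequality in `L²` this also gives `∑ |ρ_n| / λ_n < ∞`. No
completeness of the eigenfunctions and no eigenvalue asymptotics are needed.
-/

noncomputable section

open MeasureTheory Set Filter Topology

namespace Subdiffusion

/-! ### The eigenvalue problem: energy form and Bessel inequalities -/

instance : IsFiniteMeasure unitMeasure := by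
  unfold unitMeasure; infer_instance

lemma integral_unitMeasure (g : ℝ → ℝ) : ∫ x, g x ∂unitMeasure = ∫ x in (0 : ℝ)..1, g x := by
  rw [intervalIntegral.integral_of_le zero_le_one, integral_Ioc_eq_integral_Ioo, unitMeasure]

lemma ae_unitMeasure_mem : ∀ᵐ x ∂unitMeasure, x ∈ Ioo (0 : ℝ) 1 :=
  ae_restrict_mem measurableSet_Ioo

lemma memLp_of_continuousOn {g : ℝ → ℝ} (hg : ContinuousOn g (Icc 0 1)) (p : ENNReal) :
    MemLp g p unitMeasure := by
  obtain ⟨C, hC⟩ := isCompact_Icc.exists_bound_of_continuousOn hg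
  refine MemLp.of_bound ?_ C ?_
  · exact (hg.mono Ioo_subset_Icc_self).aestronglyMeasurable measurableSet_Ioo
  · filter_upwards [ae_unitMeasure_mem] with x hx using hC x (Ioo_subset_Icc_self hx)

lemma integrable_of_continuousOn {g : ℝ → ℝ} (hg : ContinuousOn g (Icc 0 1)) :
    Integrable g unitMeasure :=
  memLp_one_iff_integrable.1 (memLp_of_continuousOn hg 1)

lemma IsAdmissible.integrable_mul {a q : ℝ → ℝ} (h : IsAdmissible a q) {g : ℝ → ℝ}
    (hg : ContinuousOn g (Icc 0 1)) : Integrable (fun x => q x * g x) unitMeasure :=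
  memLp_one_iff_integrable.1 (MemLp.mul (memLp_of_continuousOn hg 1) h.memLp)

lemma continuousOn_derivWithin {v : ℝ → ℝ} (hv : ContDiffOn ℝ 1 v (Icc 0 1)) :
    ContinuousOn (derivWithin v (Icc 0 1)) (Icc 0 1) :=
  hv.continuousOn_derivWithin (uniqueDiffOn_Icc zero_lt_one) le_rfl

lemma derivWithin_Icc_eq_deriv {x : ℝ} (v : ℝ → ℝ) (hx : x ∈ Ioo (0 : ℝ) 1) :
    derivWithin v (Icc 0 1) x = deriv v x :=
  derivWithin_of_mem_nhds (Icc_mem_nhds hx.1 hx.2)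

/-- The bilinear energy form `∫ (a u' v' + q u v)` of the elliptic operator. -/
def energy (a q u v : ℝ → ℝ) : ℝ :=
  ∫ x, (flux a u x * derivWithin v (Icc 0 1) x + q x * (u x * v x)) ∂unitMeasure

lemma IsAdmissible.continuousOn_flux {a q u : ℝ → ℝ} (h : IsAdmissible a q)
    (hu : ContDiffOn ℝ 1 u (Icc 0 1)) : ContinuousOn (flux a u) (Icc 0 1) :=
  h.contDiffOn.continuousOn.mul (continuousOn_derivWithin hu)

lemma IsAdmissible.integrable_energy {a q u v : ℝ → ℝ} (h : IsAdmissible a q)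
    (hu : ContDiffOn ℝ 1 u (Icc 0 1)) (hv : ContDiffOn ℝ 1 v (Icc 0 1)) :
    Integrable (fun x => flux a u x * derivWithin v (Icc 0 1) x + q x * (u x * v x))
      unitMeasure :=
  (integrable_of_continuousOn ((h.continuousOn_flux hu).mul (continuousOn_derivWithin hv))).add
    (h.integrable_mul (hu.continuousOn.mul hv.continuousOn))

lemma energy_comm (a q u v : ℝ → ℝ) : energy a q u v = energy a q v u := by
  unfold energy flux
  congr 1; ext x; ring

lemma l2Inner_comm (u v : ℝ → ℝ) : l2Inner u v = l2Inner v u := by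
  simp only [l2Inner, mul_comm]

/-- Weak form of the eigenvalue equation: the boundary terms of the integration by parts vanish
since the flux of `ψ` is zero at `0` and the test function at `1`. -/
lemma IsEigenpair.energy_eq {a q ψ v : ℝ → ℝ} {μ : ℝ} (h : IsAdmissible a q)
    (hψ : IsEigenpair a q μ ψ) (hv : ContDiffOn ℝ 1 v (Icc 0 1)) (hv1 : v 1 = 0) :
    energy a q ψ v = μ * l2Inner ψ v := by
  have hψc := hψ.inDomain.contDiffOn
  have hAC : AbsolutelyContinuousOnInterval v 0 1 :=
    ContDiffOn.absolutelyContinuousOnInterval (by rwa [uIcc_of_le zero_le_one])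
  have key := hψ.inDomain.absolutelyContinuous.integral_mul_deriv_eq_deriv_mul hAC
  have h0 : flux a ψ 0 = 0 := by simp [flux, hψ.inDomain.neumann]
  rw [hv1, h0, mul_zero, zero_mul, sub_zero, zero_sub, ← integral_unitMeasure,
    ← integral_unitMeasure] at key
  have e1 : ∫ x, flux a ψ x * derivWithin v (Icc 0 1) x ∂unitMeasure
      = ∫ x, flux a ψ x * deriv v x ∂unitMeasure := by
    refine integral_congr_ae ?_
    filter_upwards [ae_unitMeasure_mem] with x hx
    rw [derivWithin_Icc_eq_deriv v hx]
  have hψv : ContinuousOn (fun x => ψ x * v x) (Icc 0 1) := hψc.continuousOn.mul hv.continuousOn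
  have e2 : ∫ x, deriv (flux a ψ) x * v x ∂unitMeasure
      = ∫ x, (q x * (ψ x * v x) - μ * (ψ x * v x)) ∂unitMeasure := by
    refine integral_congr_ae ?_
    filter_upwards [hψ.eigen] with x hx
    simp only [ellipticOp] at hx
    linear_combination (-v x) * hx
  rw [integral_sub (h.integrable_mul hψv) ((integrable_of_continuousOn hψv).const_mul μ),
    integral_const_mul] at e2
  have hi : Integrable (fun x => flux a ψ x * derivWithin v (Icc 0 1) x) unitMeasure :=
    integrable_of_continuousOn ((h.continuousOn_flux hψc).mul (continuousOn_derivWithin hv))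
  rw [energy, integral_add hi (h.integrable_mul hψv), e1, key, e2, l2Inner]
  ring

/-- Pointwise Poincaré inequality: `|v(x)| ≤ ∫ |v'|`, and the square of this mean is at most
`∫ v'²`. -/
lemma sq_le_integral_derivWithin_sq {v : ℝ → ℝ} (hv : ContDiffOn ℝ 1 v (Icc 0 1)) (hv1 : v 1 = 0)
    {x : ℝ} (hx : x ∈ Icc (0 : ℝ) 1) :
    v x ^ 2 ≤ ∫ y, derivWithin v (Icc 0 1) y ^ 2 ∂unitMeasure := by
  set d := derivWithin v (Icc 0 1) with hd
  have hdc : ContinuousOn d (Icc 0 1) := continuousOn_derivWithin hv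
  set m := ∫ y, |d y| ∂unitMeasure with hm
  have hm0 : |v x| ≤ m := by
    have hAC : AbsolutelyContinuousOnInterval v x 1 :=
      ContDiffOn.absolutelyContinuousOnInterval
        (hv.mono (by rw [uIcc_of_le hx.2]; exact Icc_subset_Icc_left hx.1))
    have := hAC.integral_deriv_eq_sub
    rw [hv1, zero_sub, intervalIntegral.integral_of_le hx.2, integral_Ioc_eq_integral_Ioo,
      setIntegral_congr_fun (g := d) measurableSet_Ioo
        (fun y hy => (derivWithin_Icc_eq_deriv v ⟨hx.1.trans_lt hy.1, hy.2⟩).symm)] at this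
    rw [← abs_neg, ← this]
    refine (abs_integral_le_integral_abs).trans ?_
    refine setIntegral_mono_set (integrable_of_continuousOn hdc.abs) ?_ ?_
    · exact Filter.Eventually.of_forall fun y => abs_nonneg _
    · exact (Ioo_subset_Ioo_left hx.1).eventuallyLE
  have h1 : 0 ≤ ∫ y, (|d y| - m) ^ 2 ∂unitMeasure := integral_nonneg fun y => sq_nonneg _
  have h2 : ∫ y, (|d y| - m) ^ 2 ∂unitMeasure = ∫ y, d y ^ 2 ∂unitMeasure - m ^ 2 := by
    have : ∀ y, (|d y| - m) ^ 2 = d y ^ 2 - (2 * m) * |d y| + m ^ 2 := fun y => by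
      rw [sub_sq, sq_abs]; ring
    simp only [this]
    have i1 : Integrable (fun y => d y ^ 2) unitMeasure := integrable_of_continuousOn (hdc.pow 2)
    have i2 := (integrable_of_continuousOn hdc.abs).const_mul (2 * m)
    have i3 : Integrable (fun y => d y ^ 2 - 2 * m * |d y|) unitMeasure := i1.sub i2
    rw [integral_add i3 (integrable_const _), integral_sub i1 i2, integral_const_mul,
      ← hm]
    simp [unitMeasure, Measure.real]
    ring
  have h3 : v x ^ 2 ≤ m ^ 2 := sq_le_sq' (by linarith [neg_abs_le (v x)])
    ((le_abs_self _).trans hm0)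
  linarith

/-- Point evaluations are bounded in the energy norm. -/
lemma sq_le_energy {a q v : ℝ → ℝ} (h : IsAdmissible a q) {a₀ : ℝ}
    (ha₀ : 0 < a₀) (ha : ∀ x ∈ Icc (0 : ℝ) 1, a₀ ≤ a x) (hv : ContDiffOn ℝ 1 v (Icc 0 1))
    (hv1 : v 1 = 0) {x : ℝ} (hx : x ∈ Icc (0 : ℝ) 1) : a₀ * v x ^ 2 ≤ energy a q v v := by
  refine (mul_le_mul_of_nonneg_left (sq_le_integral_derivWithin_sq hv hv1 hx) ha₀.le).trans ?_
  rw [← integral_const_mul]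
  refine integral_mono_ae
    ((integrable_of_continuousOn ((continuousOn_derivWithin hv).pow 2)).const_mul _)
    (h.integrable_energy hv hv) ?_
  filter_upwards [ae_unitMeasure_mem, h.nonneg] with y hy hq
  have := ha y (Ioo_subset_Icc_self hy)
  simp only [flux]
  nlinarith [mul_nonneg hq (mul_self_nonneg (v y)),
    mul_le_mul_of_nonneg_right this (sq_nonneg (derivWithin v (Icc 0 1) y))]

section EigenSystem

variable {a q : ℝ → ℝ} {lam : ℕ → ℝ} {φ : ℕ → ℝ → ℝ}

lemma IsEigenSystem.contDiffOn (hφ : IsEigenSystem a q lam φ) (n : ℕ) :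
    ContDiffOn ℝ 1 (φ n) (Icc 0 1) := (hφ.isEigenpair n).inDomain.contDiffOn

lemma IsEigenSystem.apply_one (hφ : IsEigenSystem a q lam φ) (n : ℕ) : φ n 1 = 0 :=
  (hφ.isEigenpair n).inDomain.dirichlet

/-- The eigenvalues are bounded below by the ellipticity constant: integrate the bound of
`φ_n(x)²` by its energy `λ_n`. -/
lemma IsEigenSystem.le_lam (haq : IsAdmissible a q) (hφ : IsEigenSystem a q lam φ) {a₀ : ℝ}
    (ha₀ : 0 < a₀) (ha : ∀ x ∈ Icc (0 : ℝ) 1, a₀ ≤ a x) (n : ℕ) : a₀ ≤ lam n := by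
  have h1 := (hφ.isEigenpair n).energy_eq haq (hφ.contDiffOn n) (hφ.apply_one n)
  rw [hφ.normalized, mul_one] at h1
  have h2 : ∫ x, a₀ * (φ n x * φ n x) ∂unitMeasure ≤ ∫ _, lam n ∂unitMeasure := by
    refine integral_mono_ae ((integrable_of_continuousOn
      ((hφ.contDiffOn n).continuousOn.mul (hφ.contDiffOn n).continuousOn)).const_mul _)
      (integrable_const _) ?_
    filter_upwards [ae_unitMeasure_mem] with x hx
    have := sq_le_energy haq ha₀ ha (hφ.contDiffOn n) (hφ.apply_one n) (Ioo_subset_Icc_self hx)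
    rw [h1] at this
    linarith [sq (φ n x)]
  rw [integral_const_mul] at h2
  have h3 := hφ.normalized n
  rw [l2Inner] at h3
  rw [h3] at h2
  simpa [unitMeasure, Measure.real] using h2

lemma IsEigenSystem.lam_pos (haq : IsAdmissible a q) (hφ : IsEigenSystem a q lam φ) (n : ℕ) :
    0 < lam n := by
  obtain ⟨a₀, ha₀, ha⟩ := haq.elliptic
  exact ha₀.trans_le (hφ.le_lam haq ha₀ ha n)

lemma IsEigenSystem.l2Inner_eq (haq : IsAdmissible a q) (hφ : IsEigenSystem a q lam φ)
    (m n : ℕ) : l2Inner (φ m) (φ n) = if m = n then 1 else 0 := by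
  split_ifs with hmn
  · rw [hmn, hφ.normalized]
  · have h1 := (hφ.isEigenpair m).energy_eq haq (hφ.contDiffOn n) (hφ.apply_one n)
    have h2 := (hφ.isEigenpair n).energy_eq haq (hφ.contDiffOn m) (hφ.apply_one m)
    rw [energy_comm, h2, l2Inner_comm] at h1
    have h3 : lam m - lam n ≠ 0 := sub_ne_zero.2 (hφ.strictMono.injective.ne hmn)
    have : (lam m - lam n) * l2Inner (φ m) (φ n) = 0 := by linarith
    exact (mul_eq_zero.1 this).resolve_left h3

/-- Bessel's inequality in the energy space for the evaluation functional at `0`. With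
`v = ∑ φ_n(0) / λ_n φ_n` (finite sum), `v(0)` and the energy of `v` are both equal to
`S = ∑ φ_n(0)² / λ_n`, so the Poincaré inequality `a₀ v(0)² ≤ energy v` bounds `S` by `1 / a₀`. -/
lemma IsEigenSystem.summable_sq_div (haq : IsAdmissible a q) (hφ : IsEigenSystem a q lam φ) :
    Summable fun n => φ n 0 ^ 2 / lam n := by
  obtain ⟨a₀, ha₀, ha⟩ := haq.elliptic
  have hpos := hφ.lam_pos haq
  refine summable_of_sum_le (c := 1 / a₀)
    (fun n => div_nonneg (sq_nonneg _) (hpos n).le) fun s => ?_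
  set S := ∑ n ∈ s, φ n 0 ^ 2 / lam n with hS
  set v : ℝ → ℝ := fun x => ∑ n ∈ s, φ n 0 / lam n * φ n x with hv
  have hvc : ContDiffOn ℝ 1 v (Icc 0 1) :=
    ContDiffOn.sum fun n _ => contDiffOn_const.mul (hφ.contDiffOn n)
  have hv1 : v 1 = 0 := by simp [hv, hφ.apply_one]
  have hv0 : v 0 = S := Finset.sum_congr rfl fun n _ => by ring
  have hd : ∀ x ∈ Icc (0 : ℝ) 1, derivWithin v (Icc 0 1) x =
      ∑ n ∈ s, φ n 0 / lam n * derivWithin (φ n) (Icc 0 1) x := by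
    intro x hx
    refine HasDerivWithinAt.derivWithin ?_ (uniqueDiffOn_Icc zero_lt_one x hx)
    refine HasDerivWithinAt.fun_sum fun n _ => HasDerivWithinAt.const_mul _ ?_
    exact ((hφ.contDiffOn n).differentiableOn one_ne_zero x hx).hasDerivWithinAt
  have hE : energy a q v v = S := by
    have e1 : energy a q v v = ∑ n ∈ s, φ n 0 / lam n * energy a q (φ n) v := by
      simp only [energy]
      simp only [← integral_const_mul]
      rw [← integral_finsetSum s fun n _ =>
        ((haq.integrable_energy (hφ.contDiffOn n) hvc).const_mul _)]
      refine integral_congr_ae ?_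
      filter_upwards [ae_unitMeasure_mem] with x hx
      simp only [mul_add, Finset.sum_add_distrib]
      congr 1
      · rw [flux, hd x (Ioo_subset_Icc_self hx), mul_assoc, Finset.sum_mul, Finset.mul_sum]
        exact Finset.sum_congr rfl fun n _ => by rw [flux]; ring
      · nth_rw 1 [hv]
        rw [Finset.sum_mul, Finset.mul_sum]
        exact Finset.sum_congr rfl fun n _ => by ring
    have e2 : ∀ n ∈ s, l2Inner (φ n) v = φ n 0 / lam n := by
      intro n hn
      have : l2Inner (φ n) v = ∑ m ∈ s, φ m 0 / lam m * l2Inner (φ n) (φ m) := by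
        simp only [l2Inner, ← integral_const_mul]
        have hi : ∀ m, Integrable (fun x => φ n x * φ m x) unitMeasure := fun m =>
          integrable_of_continuousOn ((hφ.contDiffOn n).continuousOn.mul
            (hφ.contDiffOn m).continuousOn)
        rw [← integral_finsetSum s fun m _ => (hi m).const_mul _]
        refine integral_congr_ae (Filter.Eventually.of_forall fun x => ?_)
        simp only [hv, Finset.mul_sum]
        exact Finset.sum_congr rfl fun m _ => by ring
      rw [this, Finset.sum_congr rfl fun m _ => by rw [hφ.l2Inner_eq haq]]
      simp [hn]
    rw [e1, hS]
    refine Finset.sum_congr rfl fun n hn => ?_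
    rw [(hφ.isEigenpair n).energy_eq haq hvc hv1, e2 n hn]
    field_simp [(hpos n).ne']
  have key := sq_le_energy haq ha₀ ha hvc hv1 (left_mem_Icc.2 zero_le_one)
  rw [hE, hv0] at key
  have hS0 : 0 ≤ S := Finset.sum_nonneg fun n _ => div_nonneg (sq_nonneg _) (hpos n).le
  rw [le_div_iff₀ ha₀]
  rcases hS0.eq_or_lt with h | h
  · rw [← h]; simp
  · nlinarith

/-- Bessel's inequality in `L²(0, 1)`. -/
lemma IsEigenSystem.summable_l2Inner_sq (haq : IsAdmissible a q) (hφ : IsEigenSystem a q lam φ)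
    {u : ℝ → ℝ} (hu : MemLp u 2 unitMeasure) : Summable fun n => l2Inner u (φ n) ^ 2 := by
  have hL := fun n => memLp_of_continuousOn (hφ.contDiffOn n).continuousOn 2
  have hin : ∀ {g k : ℝ → ℝ} (hg : MemLp g 2 unitMeasure) (hk : MemLp k 2 unitMeasure),
      inner ℝ (hg.toLp g) (hk.toLp k) = l2Inner k g := by
    intro g k hg hk
    rw [L2.inner_def, l2Inner]
    refine integral_congr_ae ?_
    filter_upwards [hg.coeFn_toLp, hk.coeFn_toLp] with x h1 h2
    simp [h1, h2]
  have ho : Orthonormal ℝ fun n => (hL n).toLp (φ n) := by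
    rw [orthonormal_iff_ite]
    intro m n
    rw [hin, hφ.l2Inner_eq haq]
    simp [eq_comm]
  have := ho.inner_products_summable (x := hu.toLp u)
  simpa [hin] using this

/-- The coefficients `ρ_n` are summable against `1 / λ_n`, by Bessel's inequalities in `L²` and in
the energy space. -/
lemma IsEigenSystem.summable_abs_rho_div (haq : IsAdmissible a q) (hφ : IsEigenSystem a q lam φ)
    {u₀ f : ℝ → ℝ} (hu₀ : MemLp u₀ 2 unitMeasure) (hf : MemLp f 2 unitMeasure) :
    Summable fun n => |rho lam φ u₀ f n| / lam n := by
  obtain ⟨a₀, ha₀, ha⟩ := haq.elliptic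
  have hpos := hφ.lam_pos haq
  have h1 := hφ.summable_l2Inner_sq haq hu₀
  have h2 := (hφ.summable_l2Inner_sq haq hf).mul_left (1 / a₀ ^ 2)
  have h3 := (hφ.summable_sq_div haq).mul_left (1 / a₀)
  refine Summable.of_nonneg_of_le (fun n => div_nonneg (abs_nonneg _) (hpos n).le) (fun n => ?_)
    ((h1.add h2).add h3)
  have hl := hφ.le_lam haq ha₀ ha n
  have hi : (lam n)⁻¹ ≤ 1 / a₀ := by rw [one_div]; exact inv_anti₀ ha₀ hl
  have hi0 : 0 ≤ (lam n)⁻¹ := inv_nonneg.2 (hpos n).le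
  set x := l2Inner u₀ (φ n)
  set y := l2Inner f (φ n)
  have e1 : |rho lam φ u₀ f n| / lam n = |(x - (lam n)⁻¹ * y) * (φ n 0 * (lam n)⁻¹)| := by
    rw [rho, abs_mul, abs_mul, abs_mul, abs_of_nonneg hi0]; ring
  rw [e1]
  have b1 : ((lam n)⁻¹ * y) ^ 2 ≤ 1 / a₀ ^ 2 * y ^ 2 := by
    rw [mul_pow, ← one_div_pow]; gcongr
  have b2 : (φ n 0 * (lam n)⁻¹) ^ 2 ≤ 1 / a₀ * (φ n 0 ^ 2 / lam n) := by
    calc (φ n 0 * (lam n)⁻¹) ^ 2 = (lam n)⁻¹ * (φ n 0 ^ 2 / lam n) := by ring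
      _ ≤ _ := by gcongr; exact div_nonneg (sq_nonneg _) (hpos n).le
  rw [abs_le]
  -- `2 |s t| ≤ s² + t²` and `(x - y)² ≤ 2 x² + 2 y²`
  constructor <;> nlinarith [sq_nonneg (x + (lam n)⁻¹ * y),
    sq_nonneg (φ n 0 * (lam n)⁻¹ - (x - (lam n)⁻¹ * y)),
    sq_nonneg (φ n 0 * (lam n)⁻¹ + (x - (lam n)⁻¹ * y))]

end EigenSystem

/-! ### The spectral density and its total mass -/

/-- The density with respect to `dr`, at `r = e ^ x`, of the measure whose Stieltjes transform is
`1 / (z ^ α + l)`: the jump of `s ↦ 1 / (s ^ α + l)` across the negative half-line at `s = -e ^ x`,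
divided by `2πi`. -/
def kern (α l x : ℝ) : ℝ :=
  Real.sin (Real.pi * α) / Real.pi * Real.exp (α * x) /
    ((Real.exp (α * x) + l * Real.cos (Real.pi * α)) ^ 2 + (l * Real.sin (Real.pi * α)) ^ 2)

section
variable {α l : ℝ}

lemma sin_pi_mul_pos (hα : α ∈ Ioo (0 : ℝ) 1) : 0 < Real.sin (Real.pi * α) :=
  Real.sin_pos_of_pos_of_lt_pi (mul_pos Real.pi_pos hα.1)
    (by nlinarith [Real.pi_pos, hα.2])

lemma kern_denom_pos (hα : α ∈ Ioo (0 : ℝ) 1) (hl : 0 < l) (x : ℝ) :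
    0 < (Real.exp (α * x) + l * Real.cos (Real.pi * α)) ^ 2 +
      (l * Real.sin (Real.pi * α)) ^ 2 := by
  have := mul_pos hl (sin_pi_mul_pos hα)
  positivity

lemma kern_nonneg (hα : α ∈ Ioo (0 : ℝ) 1) (hl : 0 < l) (x : ℝ) : 0 ≤ kern α l x := by
  have := sin_pi_mul_pos hα
  have := kern_denom_pos hα hl x
  have := Real.pi_pos
  unfold kern
  positivity

lemma continuous_kern (hα : α ∈ Ioo (0 : ℝ) 1) (hl : 0 < l) : Continuous (kern α l) := by
  unfold kern
  refine Continuous.div (by fun_prop) (by fun_prop) fun x => (kern_denom_pos hα hl x).ne'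

/-- An explicit primitive of `kern α l`. -/
def kernPrimitive (α l x : ℝ) : ℝ :=
  (Real.pi * α * l)⁻¹ * Real.arctan
    ((Real.exp (α * x) + l * Real.cos (Real.pi * α)) / (l * Real.sin (Real.pi * α)))

lemma hasDerivAt_kernPrimitive (hα : α ∈ Ioo (0 : ℝ) 1) (hl : 0 < l) (x : ℝ) :
    HasDerivAt (kernPrimitive α l) (kern α l x) x := by
  have hs := sin_pi_mul_pos hα
  have hD := kern_denom_pos hα hl x
  have hp := Real.pi_pos
  have h0 := hα.1
  have h1 : HasDerivAt (fun x => Real.exp (α * x)) (Real.exp (α * x) * (α * 1)) x :=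
    ((hasDerivAt_id x).const_mul α).exp
  have h2 := ((((h1.add_const (l * Real.cos (Real.pi * α))).div_const
    (l * Real.sin (Real.pi * α))).arctan).const_mul (Real.pi * α * l)⁻¹)
  refine h2.congr_deriv ?_
  unfold kern
  have e : 1 + ((Real.exp (α * x) + l * Real.cos (Real.pi * α)) / (l * Real.sin (Real.pi * α))) ^ 2
    = ((Real.exp (α * x) + l * Real.cos (Real.pi * α)) ^ 2 +
      (l * Real.sin (Real.pi * α)) ^ 2) / (l * Real.sin (Real.pi * α)) ^ 2 := by
    rw [div_pow, add_div (_ ^ 2), div_self (pow_ne_zero 2 (by positivity)), add_comm]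
  rw [e]
  field_simp

lemma tendsto_kernPrimitive_atTop (hα : α ∈ Ioo (0 : ℝ) 1) (hl : 0 < l) :
    Tendsto (kernPrimitive α l) atTop (𝓝 ((Real.pi * α * l)⁻¹ * (Real.pi / 2))) := by
  have hs := mul_pos hl (sin_pi_mul_pos hα)
  refine Tendsto.const_mul _ ((tendsto_nhds_of_tendsto_nhdsWithin
    Real.tendsto_arctan_atTop).comp (Tendsto.atTop_div_const hs ?_))
  exact tendsto_atTop_add_const_right _ _
    (Real.tendsto_exp_atTop.comp (tendsto_id.const_mul_atTop hα.1))

lemma tendsto_kernPrimitive_atBot (hα : α ∈ Ioo (0 : ℝ) 1) (hl : 0 < l) :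
    Tendsto (kernPrimitive α l) atBot
      (𝓝 ((Real.pi * α * l)⁻¹ * (Real.pi / 2 - Real.pi * α))) := by
  have hs := sin_pi_mul_pos hα
  have hp := Real.pi_pos
  have e : Real.pi / 2 - Real.pi * α = Real.arctan
      ((0 + l * Real.cos (Real.pi * α)) / (l * Real.sin (Real.pi * α))) := by
    have : (0 + l * Real.cos (Real.pi * α)) / (l * Real.sin (Real.pi * α))
        = Real.tan (Real.pi / 2 - Real.pi * α) := by
      rw [Real.tan_pi_div_two_sub, Real.tan_eq_sin_div_cos, inv_div, zero_add,
        mul_div_mul_left _ _ hl.ne']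
    rw [this, Real.arctan_tan] <;> nlinarith [hα.1, hα.2]
  rw [e]
  refine Tendsto.const_mul _ ((Real.continuous_arctan.tendsto _).comp
    (Tendsto.div_const (Tendsto.add_const _ ?_) _))
  exact Real.tendsto_exp_atBot.comp (tendsto_id.const_mul_atBot hα.1)

lemma integrable_kern (hα : α ∈ Ioo (0 : ℝ) 1) (hl : 0 < l) : Integrable (kern α l) := by
  rw [← integrableOn_univ, ← Iic_union_Ioi (a := (0 : ℝ))]
  have hneg : IntegrableOn (kern α l) (Iic 0) := by
    refine integrableOn_Iic_of_intervalIntegral_norm_tendsto _ 0 (a := fun x => x)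
      (fun x => (continuous_kern hα hl).integrableOn_Ioc) Filter.tendsto_id
      ((tendsto_kernPrimitive_atBot hα hl).const_sub (kernPrimitive α l 0) |>.congr fun x => ?_)
    simp only [Real.norm_of_nonneg (kern_nonneg hα hl _)]
    exact (intervalIntegral.integral_eq_sub_of_hasDerivAt
      (fun x _ => hasDerivAt_kernPrimitive hα hl x)
      ((continuous_kern hα hl).intervalIntegrable _ _)).symm
  exact hneg.union
    (integrableOn_Ioi_deriv_of_nonneg'
      (fun x _ => hasDerivAt_kernPrimitive hα hl x) (fun x _ => kern_nonneg hα hl x)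
      (tendsto_kernPrimitive_atTop hα hl))

lemma integral_kern (hα : α ∈ Ioo (0 : ℝ) 1) (hl : 0 < l) : ∫ x, kern α l x = 1 / l := by
  rw [integral_of_hasDerivAt_of_tendsto (hasDerivAt_kernPrimitive hα hl) (integrable_kern hα hl)
    (tendsto_kernPrimitive_atBot hα hl) (tendsto_kernPrimitive_atTop hα hl)]
  have := Real.pi_pos
  have := hα.1
  field_simp
  ring

end

open Complex

/-! ### Stieltjes transform of the spectral density by Cauchy's theorem -/

/-- The denominator `s ^ α + l` has no zero on the cut plane, both sides of the cut included, since
`α < 1`; here `s = exp w`. -/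
lemma exp_mul_add_ne_zero {α l : ℝ} (hα : α ∈ Ioo (0 : ℝ) 1) (hl : 0 < l) {w : ℂ}
    (hw : |w.im| ≤ Real.pi) : cexp (α * w) + l ≠ 0 := by
  intro h
  obtain ⟨h1, h2⟩ := abs_le.1 hw
  have hre := congrArg Complex.re h
  have him := congrArg Complex.im h
  simp only [add_re, exp_re, add_im, exp_im, re_ofReal_mul, im_ofReal_mul, ofReal_re, ofReal_im,
    zero_re, zero_im, add_zero] at hre him
  have hp := Real.pi_pos
  have hs : Real.sin (α * w.im) = 0 := (mul_eq_zero.1 him).resolve_left (Real.exp_pos _).ne'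
  rw [Real.sin_eq_zero_iff_of_lt_of_lt (by nlinarith [hα.1, hα.2]) (by nlinarith [hα.1, hα.2])]
    at hs
  rw [hs, Real.cos_zero, mul_one] at hre
  linarith [Real.exp_pos (α * w.re)]

/-- The function `w ↦ 1 / (s ^ α + l)` at `s = exp w`, on the logarithmic strip. -/
def resolventExp (α l : ℝ) (w : ℂ) : ℂ := 1 / (cexp (α * w) + l)

/-- The two sides `Im w = ∓π` of the cut differ by the spectral density. -/
lemma resolventExp_jump {α l : ℝ} (hα : α ∈ Ioo (0 : ℝ) 1) (hl : 0 < l) (x : ℝ) :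
    resolventExp α l (x + (-Real.pi : ℝ) * I) - resolventExp α l (x + Real.pi * I) =
      2 * Real.pi * I * kern α l x := by
  have n1 : cexp (α * (x + (-Real.pi : ℝ) * I)) + l ≠ 0 :=
    exp_mul_add_ne_zero hα hl (by simp [abs_of_pos Real.pi_pos])
  have n2 : cexp (α * (x + Real.pi * I)) + l ≠ 0 :=
    exp_mul_add_ne_zero hα hl (by simp [abs_of_pos Real.pi_pos])
  have hD : (((Real.exp (α * x) + l * Real.cos (Real.pi * α)) ^ 2 +
      (l * Real.sin (Real.pi * α)) ^ 2 : ℝ) : ℂ) ≠ 0 :=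
    ofReal_ne_zero.2 (kern_denom_pos hα hl x).ne'
  have hp : (Real.pi : ℂ) ≠ 0 := ofReal_ne_zero.2 Real.pi_ne_zero
  have e1 : cexp (α * (x + (-Real.pi : ℝ) * I)) =
      Real.exp (α * x) * (Real.cos (Real.pi * α) - Real.sin (Real.pi * α) * I) := by
    have : (α * (x + (-Real.pi : ℝ) * I) : ℂ) = (α * x : ℝ) + (-(Real.pi * α) : ℝ) * I := by
      push_cast; ring
    rw [this, Complex.exp_add, exp_mul_I, ← ofReal_exp, ← ofReal_cos, ← ofReal_sin, Real.cos_neg,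
      Real.sin_neg]
    push_cast; ring
  have e2 : cexp (α * (x + Real.pi * I)) =
      Real.exp (α * x) * (Real.cos (Real.pi * α) + Real.sin (Real.pi * α) * I) := by
    have : (α * (x + Real.pi * I) : ℂ) = (α * x : ℝ) + ((Real.pi * α) : ℝ) * I := by
      push_cast; ring
    rw [this, Complex.exp_add, exp_mul_I, ← ofReal_exp, ← ofReal_cos, ← ofReal_sin]
  have hcs : (Real.cos (Real.pi * α) : ℂ) ^ 2 + (Real.sin (Real.pi * α) : ℂ) ^ 2 = 1 := by
    rw [← ofReal_pow, ← ofReal_pow, ← ofReal_add, Real.cos_sq_add_sin_sq, ofReal_one]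
  unfold resolventExp kern
  rw [e1] at n1 ⊢
  rw [e2] at n2 ⊢
  push_cast [-ofReal_exp, -ofReal_cos, -ofReal_sin] at hD ⊢
  generalize (Real.exp (α * x) : ℂ) = X at *
  generalize (Real.cos (Real.pi * α) : ℂ) = c at *
  generalize (Real.sin (Real.pi * α) : ℂ) = s at *
  have e3 : (X * (c - s * I) + l) * (X * (c + s * I) + l) = (X + l * c) ^ 2 + (l * s) ^ 2 := by
    linear_combination (-(X * s) ^ 2) * I_sq + (X ^ 2 - l ^ 2) * hcs
  rw [div_sub_div _ _ n1 n2, e3, mul_div_assoc', div_left_inj' hD]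
  field_simp
  ring

/-- The Cauchy integrand `e ^ w (g(w) - g(w₀)) / (e ^ w - e ^ w₀)` with `g = resolventExp α l`, as a
quotient of two divided differences so that the singularity at `w₀` is removed. -/
def stripIntegrand (α l : ℝ) (w₀ w : ℂ) : ℂ :=
  cexp w * dslope (resolventExp α l) w₀ w / dslope cexp w₀ w

lemma stripIntegrand_eq {α l : ℝ} {w₀ w : ℂ} (hw : w ≠ w₀) : stripIntegrand α l w₀ w =
    cexp w * (resolventExp α l w - resolventExp α l w₀) / (cexp w - cexp w₀) := by
  have : w - w₀ ≠ 0 := sub_ne_zero.2 hw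
  rw [stripIntegrand, dslope_of_ne _ hw, dslope_of_ne _ hw, slope_def_field, slope_def_field,
    mul_div_assoc', div_div_div_cancel_right₀ this]

lemma differentiableAt_stripIntegrand {α l : ℝ} (hα : α ∈ Ioo (0 : ℝ) 1) (hl : 0 < l) {w₀ w : ℂ}
    (hw₀ : |w₀.im| < Real.pi) (hw : |w.im| ≤ Real.pi) :
    DifferentiableAt ℂ (stripIntegrand α l w₀) w := by
  have hV : IsOpen {w : ℂ | cexp (α * w) + l ≠ 0} :=
    isOpen_ne_fun (by fun_prop) (by fun_prop)
  have hg : DifferentiableOn ℂ (resolventExp α l) {w : ℂ | cexp (α * w) + l ≠ 0} := by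
    intro w hw
    refine DifferentiableAt.differentiableWithinAt ?_
    unfold resolventExp
    exact DifferentiableAt.div (by fun_prop) (by fun_prop) hw
  have h1 : DifferentiableAt ℂ (dslope (resolventExp α l) w₀) w :=
    ((differentiableOn_dslope (hV.mem_nhds (exp_mul_add_ne_zero hα hl hw₀.le))).2
      hg).differentiableAt
      (hV.mem_nhds (exp_mul_add_ne_zero hα hl hw))
  have h2 : DifferentiableAt ℂ (dslope cexp w₀) w :=
    ((differentiableOn_dslope univ_mem).2 Complex.differentiable_exp.differentiableOn
      ).differentiableAt
      univ_mem
  refine (Complex.differentiable_exp.differentiableAt.mul h1).div h2 ?_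
  rcases eq_or_ne w w₀ with rfl | hne
  · simp [dslope_same]
  · rw [dslope_of_ne _ hne, slope_def_field]
    refine div_ne_zero (sub_ne_zero.2 fun h => ?_) (sub_ne_zero.2 hne)
    obtain ⟨n, hn⟩ := Complex.exp_eq_exp_iff_exists_int.1 h
    have him := congrArg Complex.im hn
    simp at him
    have hp := Real.pi_pos
    obtain ⟨a1, a2⟩ := abs_le.1 hw
    obtain ⟨b1, b2⟩ := abs_lt.1 hw₀
    have n0 : n = 0 := by
      have c1 : (n : ℝ) < 1 := by nlinarith
      have c2 : (-1 : ℝ) < n := by nlinarith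
      have c1' : n < 1 := by exact_mod_cast c1
      have c2' : -1 < n := by exact_mod_cast c2
      omega
    exact hne (by simpa [n0] using hn)

/-- Integrals along vertical segments moving to `Re = ±∞`, according to `L`. -/
lemma tendsto_integral_vertical {F : ℂ → ℂ} (hF : Measurable F) {c : ℂ} {L : Filter ℝ}
    [L.IsCountablyGenerated] (h : Tendsto F (comap re L) (𝓝 c)) :
    Tendsto (fun R : ℝ => ∫ y in (-Real.pi)..Real.pi, F (R + y * I)) L
      (𝓝 (2 * Real.pi * c)) := by
  have e : (2 * Real.pi * c : ℂ) = ∫ _ in (-Real.pi)..Real.pi, c := by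
    rw [intervalIntegral.integral_const, real_smul]
    push_cast; ring
  rw [e]
  refine intervalIntegral.tendsto_integral_filter_of_dominated_convergence (fun _ => ‖c‖ + 1)
    (Eventually.of_forall fun R => ?_) ?_ (by simp) ?_
  · exact (hF.comp (by fun_prop)).aestronglyMeasurable
  · have h1 : ∀ᶠ w in comap re L, ‖F w‖ < ‖c‖ + 1 := h.norm.eventually_lt_const (by linarith)
    rw [eventually_comap] at h1
    filter_upwards [h1] with R hR
    exact Eventually.of_forall fun y _ => (hR _ (by simp)).le
  · refine Eventually.of_forall fun y _ => h.comp (tendsto_comap_iff.2 ?_)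
    have : re ∘ (fun R : ℝ => (R + y * I : ℂ)) = id := by ext; simp
    rw [this]; exact tendsto_id

lemma tendsto_exp_mul_comap_re_atBot {c : ℝ} (hc : 0 < c) :
    Tendsto (fun w : ℂ => cexp (c * w)) (comap re atBot) (𝓝 0) := by
  refine tendsto_exp_comap_re_atBot.comp (tendsto_comap_iff.2 ?_)
  have : re ∘ (fun w : ℂ => (c * w : ℂ)) = fun w => c * w.re := by ext; simp
  rw [this]
  exact tendsto_comap.const_mul_atBot hc

lemma tendsto_exp_neg_mul_comap_re_atTop {c : ℝ} (hc : 0 < c) :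
    Tendsto (fun w : ℂ => cexp (-(c * w))) (comap re atTop) (𝓝 0) := by
  refine tendsto_exp_comap_re_atBot.comp (tendsto_comap_iff.2 ?_)
  have : re ∘ (fun w : ℂ => (-(c * w) : ℂ)) = fun w => -(c * w.re) := by ext; simp
  rw [this]
  exact tendsto_neg_atTop_atBot.comp (tendsto_comap.const_mul_atTop hc)

lemma tendsto_stripIntegrand_atTop {α l : ℝ} (hα : α ∈ Ioo (0 : ℝ) 1) (w₀ : ℂ) :
    Tendsto (fun w => cexp w * (resolventExp α l w - resolventExp α l w₀) / (cexp w - cexp w₀))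
      (comap re atTop) (𝓝 (-resolventExp α l w₀)) := by
  have h1 := tendsto_exp_neg_mul_comap_re_atTop hα.1
  have h2 := tendsto_exp_neg_mul_comap_re_atTop one_pos
  have h3 : Tendsto (fun w : ℂ => (cexp (-(α * w)) / (1 + l * cexp (-(α * w))) -
      resolventExp α l w₀) / (1 - cexp w₀ * cexp (-((1 : ℝ) * w)))) (comap re atTop)
      (𝓝 ((0 / (1 + l * 0) - resolventExp α l w₀) / (1 - cexp w₀ * 0))) :=
    ((h1.div (tendsto_const_nhds.add (h1.const_mul _)) (by simp)).sub tendsto_const_nhds).div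
      (tendsto_const_nhds.sub (h2.const_mul _)) (by simp)
  have e0 : (0 / (1 + l * 0) - resolventExp α l w₀) / (1 - cexp w₀ * 0)
      = -resolventExp α l w₀ := by simp
  rw [e0] at h3
  refine h3.congr fun w => ?_
  have a1 : cexp (-(α * w)) / (1 + l * cexp (-(α * w))) = resolventExp α l w := by
    rw [resolventExp, ← mul_div_mul_left _ _ (exp_ne_zero (α * w)), mul_add,
      mul_left_comm, ← Complex.exp_add]
    simp
  rw [a1, ← mul_div_mul_left _ _ (exp_ne_zero w), mul_sub (cexp w) 1, mul_left_comm,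
    ← Complex.exp_add]
  simp

lemma tendsto_stripIntegrand_atBot {α l : ℝ} (hα : α ∈ Ioo (0 : ℝ) 1) (hl : 0 < l) (w₀ : ℂ) :
    Tendsto (fun w => cexp w * (resolventExp α l w - resolventExp α l w₀) / (cexp w - cexp w₀))
      (comap re atBot) (𝓝 0) := by
  have h1 := tendsto_exp_mul_comap_re_atBot hα.1
  have h2 := tendsto_exp_comap_re_atBot
  have hl' : (l : ℂ) ≠ 0 := ofReal_ne_zero.2 hl.ne'
  have h3 := (h2.mul (((tendsto_const_nhds (x := (1 : ℂ))).div (h1.add_const (l : ℂ))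
    (by simpa using hl')).sub_const (resolventExp α l w₀))).div (h2.sub_const (cexp w₀))
    (by simp [exp_ne_zero])
  simp only [zero_mul, zero_div] at h3
  exact h3

/-- The Stieltjes representation of `1 / (z ^ α + l)`, by Cauchy's theorem on the boundary of
`[-R, R] × [-π, π]` in the logarithmic variable `w`, `R → ∞`: the horizontal sides give the
integral, the right side the value `g(w₀)`, the left side nothing. -/
theorem integral_kern_mul_stieltjes {α l : ℝ} (hα : α ∈ Ioo (0 : ℝ) 1) (hl : 0 < l) {z : ℂ}
    (hz : 0 < z.re) :
    ∫ x : ℝ, (kern α l x : ℂ) * (Real.exp x / (z + Real.exp x)) = 1 / (z ^ (α : ℂ) + l) := by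
  have hz0 : z ≠ 0 := by rintro rfl; simp at hz
  have hp := Real.pi_pos
  set w₀ := log z with hw₀
  have hew : cexp w₀ = z := exp_log hz0
  have him : |w₀.im| < Real.pi := by
    rw [hw₀, log_im]
    exact (abs_arg_lt_pi_div_two_iff.2 (Or.inl hz)).trans (by linarith)
  have hzx : ∀ x : ℝ, z + Real.exp x ≠ 0 := fun x h => by
    have := congrArg re h
    simp only [add_re, ofReal_re, zero_re] at this
    linarith [Real.exp_pos x]
  set F : ℂ → ℂ := fun w =>
    cexp w * (resolventExp α l w - resolventExp α l w₀) / (cexp w - cexp w₀) with hF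
  have hFm : Measurable F := by
    have : Measurable (resolventExp α l) := by unfold resolventExp; fun_prop
    fun_prop
  have hint : Integrable fun x : ℝ => (kern α l x : ℂ) * (Real.exp x / (z + Real.exp x)) := by
    refine (integrable_kern hα hl).ofReal.mul_bdd (c := 1) ?_ ?_
    · exact (Continuous.div (by fun_prop) (by fun_prop) hzx).aestronglyMeasurable
    · refine Eventually.of_forall fun x => ?_
      rw [norm_div, div_le_one (norm_pos_iff.2 (hzx x))]
      refine le_trans ?_ (abs_re_le_norm _)
      simp only [add_re, ofReal_re, norm_real, Real.norm_eq_abs]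
      rw [abs_of_pos (Real.exp_pos x), abs_of_pos (by positivity)]
      linarith
  -- the horizontal sides
  have hhor : ∀ x : ℝ, stripIntegrand α l w₀ (x + (-Real.pi : ℝ) * I) -
      stripIntegrand α l w₀ (x + Real.pi * I) =
      2 * Real.pi * I * ((kern α l x : ℂ) * (Real.exp x / (z + Real.exp x))) := by
    intro x
    have n1 : (x + (-Real.pi : ℝ) * I : ℂ) ≠ w₀ := fun h => by
      rw [← h] at him; simp [abs_of_pos hp] at him
    have n2 : (x + Real.pi * I : ℂ) ≠ w₀ := fun h => by
      rw [← h] at him; simp [abs_of_pos hp] at him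
    have e1 : cexp (x + (-Real.pi : ℝ) * I) = -Real.exp x := by
      rw [Complex.exp_add, ofReal_neg, neg_mul, Complex.exp_neg, exp_pi_mul_I, ofReal_exp]
      norm_num
    have e2 : cexp (x + Real.pi * I) = -Real.exp x := by
      rw [Complex.exp_add, exp_pi_mul_I, ofReal_exp, mul_neg_one]
    have hn : -(Real.exp x : ℂ) - z ≠ 0 := by
      intro h; exact hzx x (by linear_combination -h)
    have hj := resolventExp_jump hα hl x
    rw [stripIntegrand_eq n1, stripIntegrand_eq n2, e1, e2, hew, div_sub_div_same]
    rw [mul_div_assoc', mul_div_assoc', div_eq_div_iff hn (hzx x)]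
    linear_combination (-(Real.exp x : ℂ)) * (z + Real.exp x) * hj
  have hcont : ∀ c : ℝ, |c| ≤ Real.pi → Continuous fun x : ℝ =>
      stripIntegrand α l w₀ (x + c * I) := fun c hc =>
    continuous_iff_continuousAt.2 fun x => ContinuousAt.comp
      (f := fun x : ℝ => (x + c * I : ℂ))
      (differentiableAt_stripIntegrand hα hl him (by simpa using hc)).continuousAt (by fun_prop)
  have hrect : ∀ᶠ R : ℝ in atTop,
      (∫ x in (-R)..R, 2 * Real.pi * I * ((kern α l x : ℂ) * (Real.exp x / (z + Real.exp x)))) +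
      I * (∫ y in (-Real.pi)..Real.pi, F (R + y * I)) -
      I * (∫ y in (-Real.pi)..Real.pi, F ((-R : ℝ) + y * I)) = 0 := by
    filter_upwards [eventually_gt_atTop |w₀.re|] with R hR
    have hR0 : 0 < R := (abs_nonneg _).trans_lt hR
    have key := integral_boundary_rect_eq_zero_of_differentiableOn (stripIntegrand α l w₀)
      ⟨-R, -Real.pi⟩ ⟨R, Real.pi⟩ (by
        intro w hw
        refine (differentiableAt_stripIntegrand hα hl him ?_).differentiableWithinAt
        have := hw.2
        simp only [mem_preimage] at this
        rw [uIcc_of_le (by linarith)] at this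
        exact abs_le.2 this)
    simp only [smul_eq_mul] at key
    rw [← intervalIntegral.integral_sub
      ((hcont (-Real.pi) (by simp [abs_of_pos hp])).intervalIntegrable _ _)
      ((hcont Real.pi (by simp [abs_of_pos hp])).intervalIntegrable _ _)] at key
    have v1 : ∀ y : ℝ, stripIntegrand α l w₀ (R + y * I) = F (R + y * I) := fun y =>
      stripIntegrand_eq fun h => by
        rw [← h] at hR; simp [abs_of_pos hR0] at hR
    have v2 : ∀ y : ℝ, stripIntegrand α l w₀ ((-R : ℝ) + y * I) = F ((-R : ℝ) + y * I) := fun y =>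
      stripIntegrand_eq fun h => by
        rw [← h] at hR; simp [abs_of_pos hR0] at hR
    simp only [hhor, v1, v2] at key
    exact key
  have hA : Tendsto (fun R : ℝ => ∫ x in (-R)..R, 2 * Real.pi * I *
      ((kern α l x : ℂ) * (Real.exp x / (z + Real.exp x)))) atTop
      (𝓝 (∫ x : ℝ, 2 * Real.pi * I * ((kern α l x : ℂ) * (Real.exp x / (z + Real.exp x))))) :=
    intervalIntegral_tendsto_integral (hint.const_mul _) tendsto_neg_atTop_atBot tendsto_id
  have hB := tendsto_integral_vertical hFm (tendsto_stripIntegrand_atTop (l := l) hα w₀)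
  have hC := (tendsto_integral_vertical hFm (tendsto_stripIntegrand_atBot hα hl w₀)).comp
    tendsto_neg_atTop_atBot
  have hlim := tendsto_nhds_unique (((hA.add (hB.const_mul I)).sub (hC.const_mul I)).congr'
    hrect) tendsto_const_nhds
  rw [integral_const_mul] at hlim
  have h2 : (2 * Real.pi * I : ℂ) ≠ 0 := two_pi_I_ne_zero
  have hfin : ∫ x : ℝ, (kern α l x : ℂ) * (Real.exp x / (z + Real.exp x)) =
      resolventExp α l w₀ := by
    refine mul_left_cancel₀ h2 ?_
    linear_combination hlim
  rw [hfin, resolventExp, cpow_def_of_ne_zero hz0, mul_comm]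

/-! ### Laplace transforms of positive weights -/

/-- `p` is the density in `x = log r` of a Stieltjes measure: a nonnegative continuous function for
which `∫ p(x) / (c + e ^ x) dx` is finite for every `c > 0`. -/
structure IsStieltjesWeight (p : ℝ → ℝ) : Prop where
  continuous : Continuous p
  nonneg : ∀ x, 0 ≤ p x
  integrable : ∀ c : ℝ, 0 < c → Integrable fun x => p x / (c + Real.exp x)

/-- The completely monotone function `∫ e ^ (-τ e ^ x) p(x) dx`, that is the Laplace transform in
`r = e ^ x` of the weight `p`, for complex `τ`. -/
def lapExp (p : ℝ → ℝ) (τ : ℂ) : ℂ := ∫ x : ℝ, cexp (-(τ * Real.exp x)) * p x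

namespace IsStieltjesWeight

variable {p : ℝ → ℝ}

lemma norm_integrand (hp : IsStieltjesWeight p) (τ : ℂ) (x : ℝ) :
    ‖cexp (-(τ * Real.exp x)) * p x‖ = Real.exp (-(τ.re * Real.exp x)) * p x := by
  rw [norm_mul, norm_exp, norm_real, Real.norm_of_nonneg (hp.nonneg x), neg_re, re_mul_ofReal]

lemma exp_mul_le (hp : IsStieltjesWeight p) {σ : ℝ} (hσ : 0 < σ) (x : ℝ) :
    Real.exp (-(σ * Real.exp x)) * p x ≤ 1 / σ * (p x / (1 / σ + Real.exp x)) := by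
  have hx := Real.exp_pos x
  have h1 : Real.exp (-(σ * Real.exp x)) ≤ 1 / (1 + σ * Real.exp x) := by
    rw [Real.exp_neg, one_div]
    exact inv_anti₀ (by positivity) (by linarith [Real.add_one_le_exp (σ * Real.exp x)])
  calc Real.exp (-(σ * Real.exp x)) * p x ≤ 1 / (1 + σ * Real.exp x) * p x :=
        mul_le_mul_of_nonneg_right h1 (hp.nonneg x)
    _ = _ := by field_simp

lemma integrable_exp_mul (hp : IsStieltjesWeight p) {σ : ℝ} (hσ : 0 < σ) :
    Integrable fun x => Real.exp (-(σ * Real.exp x)) * p x := by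
  refine ((hp.integrable (1 / σ) (by positivity)).const_mul (1 / σ)).mono' ?_ ?_
  · have := hp.continuous
    exact Continuous.aestronglyMeasurable (by fun_prop)
  · refine Eventually.of_forall fun x => ?_
    rw [Real.norm_of_nonneg (mul_nonneg (Real.exp_pos _).le (hp.nonneg x))]
    exact hp.exp_mul_le hσ x

lemma continuous_integrand (hp : IsStieltjesWeight p) (τ : ℂ) :
    Continuous fun x : ℝ => cexp (-(τ * Real.exp x)) * p x := by
  have := hp.continuous
  fun_prop

/-- A bound on a half-plane by the Stieltjes transform of the weight. -/
lemma norm_lapExp_le (hp : IsStieltjesWeight p) {σ : ℝ} (hσ : 0 < σ) {τ : ℂ} (hτ : σ ≤ τ.re) :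
    ‖lapExp p τ‖ ≤ 1 / σ * ∫ x, p x / (1 / σ + Real.exp x) := by
  refine (norm_integral_le_integral_norm _).trans ?_
  simp only [hp.norm_integrand]
  rw [← integral_const_mul]
  refine integral_mono (hp.integrable_exp_mul (hσ.trans_le hτ))
    ((hp.integrable (1 / σ) (by positivity)).const_mul _)
    fun x => le_trans ?_ (hp.exp_mul_le hσ x)
  exact mul_le_mul_of_nonneg_right (by gcongr) (hp.nonneg x)

lemma differentiableOn_lapExp (hp : IsStieltjesWeight p) :
    DifferentiableOn ℂ (lapExp p) {τ | 0 < τ.re} := by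
  intro τ₀ hτ₀
  have hτ₀' : 0 < τ₀.re := hτ₀
  refine DifferentiableAt.differentiableWithinAt ?_
  have hs : {τ : ℂ | τ₀.re / 2 < τ.re} ∈ 𝓝 τ₀ :=
    (isOpen_lt continuous_const continuous_re).mem_nhds (by simpa using hτ₀')
  have hcont := hp.continuous
  refine (hasDerivAt_integral_of_dominated_loc_of_deriv_le
    (F := fun τ x => cexp (-(τ * Real.exp x)) * p x)
    (F' := fun τ x => cexp (-(τ * Real.exp x)) * (-(1 * Real.exp x)) * p x)
    (bound := fun x => 4 / τ₀.re * (Real.exp (-(τ₀.re / 4 * Real.exp x)) * p x)) hs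
    (Eventually.of_forall fun τ => (hp.continuous_integrand τ).aestronglyMeasurable) ?_
    (Continuous.aestronglyMeasurable (by fun_prop)) ?_
    ((hp.integrable_exp_mul (by positivity)).const_mul _) ?_).2.differentiableAt
  · refine (integrable_norm_iff (hp.continuous_integrand τ₀).aestronglyMeasurable).1 ?_
    simp only [hp.norm_integrand]
    exact hp.integrable_exp_mul hτ₀'
  · refine Eventually.of_forall fun x τ hτ => ?_
    have hτ' : τ₀.re / 2 < τ.re := hτ
    have hx := Real.exp_pos x
    rw [norm_mul, norm_mul, norm_exp, norm_real, Real.norm_of_nonneg (hp.nonneg x), neg_re,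
      re_mul_ofReal, one_mul, norm_neg, norm_real, Real.norm_of_nonneg hx.le, ← mul_assoc]
    refine mul_le_mul_of_nonneg_right ?_ (hp.nonneg x)
    -- half of the exponential decay absorbs the factor `e ^ x`
    have h1 : Real.exp x ≤ 4 / τ₀.re * Real.exp (τ₀.re / 4 * Real.exp x) := by
      have := Real.add_one_le_exp (τ₀.re / 4 * Real.exp x)
      rw [div_mul_eq_mul_div, le_div_iff₀ hτ₀']
      linarith
    calc Real.exp (-(τ.re * Real.exp x)) * Real.exp x
        ≤ Real.exp (-(τ₀.re / 2 * Real.exp x)) *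
          (4 / τ₀.re * Real.exp (τ₀.re / 4 * Real.exp x)) := by gcongr
      _ = 4 / τ₀.re * Real.exp (-(τ₀.re / 4 * Real.exp x)) := by
        rw [mul_left_comm, ← Real.exp_add]; congr 2; ring
  · refine Eventually.of_forall fun x τ _ => ?_
    exact ((((hasDerivAt_id τ).mul_const _).neg).cexp).mul_const _

lemma integrable_prod (hp : IsStieltjesWeight p) {z : ℂ} (hz : 0 < z.re) :
    Integrable (fun tx : ℝ × ℝ => cexp (-z * tx.1) * (cexp (-(tx.1 * Real.exp tx.2)) * p tx.2))
      ((volume.restrict (Ioi 0)).prod volume) := by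
  have hcont := hp.continuous
  rw [integrable_prod_iff' (Continuous.aestronglyMeasurable (by fun_prop))]
  have e : ∀ t x : ℝ, cexp (-z * t) * (cexp (-(t * Real.exp x)) * p x) =
      cexp ((-(z + Real.exp x)) * t) * p x := fun t x => by
    rw [← mul_assoc, ← Complex.exp_add]; congr 2; ring
  have hre : ∀ x : ℝ, (-(z + Real.exp x)).re < 0 := fun x => by
    simp only [neg_re, add_re, ofReal_re]; linarith [Real.exp_pos x]
  constructor
  · refine Eventually.of_forall fun x => ?_
    simp only [e]
    exact (integrableOn_exp_mul_complex_Ioi (hre x) 0).mul_const _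
  · refine (hp.integrable z.re hz).congr (Eventually.of_forall fun x => ?_)
    have h1 : ∀ t : ℝ, ‖cexp ((-(z + Real.exp x)) * t) * p x‖ =
        Real.exp ((-(z.re + Real.exp x)) * t) * p x := fun t => by
      rw [norm_mul, norm_exp, norm_real, Real.norm_of_nonneg (hp.nonneg x), re_mul_ofReal, neg_re,
        add_re, ofReal_re]
    simp only [e, h1]
    rw [integral_mul_const, integral_exp_mul_Ioi (by linarith [Real.exp_pos x])]
    have : z.re + Real.exp x ≠ 0 := by positivity
    rw [mul_zero, Real.exp_zero, neg_div_neg_eq, mul_comm, mul_one_div]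

lemma laplaceIntegrand_lapExp (p : ℝ → ℝ) (z : ℂ) (t : ℝ) :
    laplaceIntegrand (fun t => lapExp p t) z t =
      ∫ x : ℝ, cexp (-z * t) * (cexp (-(t * Real.exp x)) * p x) := by
  rw [laplaceIntegrand, lapExp, integral_const_mul]

lemma laplaceConvergent_lapExp (hp : IsStieltjesWeight p) {z : ℂ} (hz : 0 < z.re) :
    LaplaceConvergent (fun t => lapExp p t) z := by
  rw [LaplaceConvergent, IntegrableOn]
  rw [funext (laplaceIntegrand_lapExp p z)]
  exact (hp.integrable_prod hz).integral_prod_left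

/-- The iterated Laplace transform of a weight is its Stieltjes transform. -/
lemma laplace_lapExp (hp : IsStieltjesWeight p) {z : ℂ} (hz : 0 < z.re) :
    laplace (fun t => lapExp p t) z = ∫ x : ℝ, (p x : ℂ) / (z + Real.exp x) := by
  simp only [laplace, laplaceIntegrand_lapExp]
  rw [integral_integral_swap (hp.integrable_prod hz)]
  refine integral_congr_ae (Eventually.of_forall fun x => ?_)
  have hre : (-(z + Real.exp x)).re < 0 := by
    simp only [neg_re, add_re, ofReal_re]; linarith [Real.exp_pos x]
  have e : ∀ t : ℝ, cexp (-z * t) * (cexp (-(t * Real.exp x)) * p x) =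
      cexp ((-(z + Real.exp x)) * t) * p x := fun t => by
    rw [← mul_assoc, ← Complex.exp_add]; congr 2; ring
  simp only [e]
  rw [integral_mul_const, integral_exp_mul_complex_Ioi hre, ofReal_zero, mul_zero, Complex.exp_zero,
    neg_div_neg_eq, mul_comm, mul_one_div]

lemma integral_norm_laplaceIntegrand_le (hp : IsStieltjesWeight p) {z : ℂ} (hz : 0 < z.re) :
    ∫ t in Ioi (0 : ℝ), ‖laplaceIntegrand (fun t => lapExp p t) z t‖ ≤
      ∫ x, p x / (z.re + Real.exp x) := by
  have h1 := (hp.integrable_prod hz).norm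
  have h2 : ∫ t in Ioi (0 : ℝ), ‖laplaceIntegrand (fun t => lapExp p t) z t‖ ≤
      ∫ t in Ioi (0 : ℝ), ∫ x : ℝ, ‖cexp (-z * t) * (cexp (-(t * Real.exp x)) * p x)‖ := by
    refine integral_mono (hp.laplaceConvergent_lapExp hz).norm h1.integral_prod_left fun t => ?_
    simp only [laplaceIntegrand_lapExp]
    exact norm_integral_le_integral_norm _
  refine h2.trans (le_of_eq ?_)
  rw [integral_integral_swap h1]
  refine integral_congr_ae (Eventually.of_forall fun x => ?_)
  have e : ∀ t : ℝ, ‖cexp (-z * t) * (cexp (-(t * Real.exp x)) * p x)‖ =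
      Real.exp ((-(z.re + Real.exp x)) * t) * p x := fun t => by
    have h : (-(t * Real.exp x) : ℂ) = ((-(t * Real.exp x) : ℝ) : ℂ) := by push_cast; ring
    rw [norm_mul, norm_mul, h, norm_exp, norm_exp, norm_real, Real.norm_of_nonneg (hp.nonneg x),
      re_mul_ofReal, ofReal_re, ← mul_assoc, ← Real.exp_add, neg_re]
    congr 2; ring
  simp only [e]
  rw [integral_mul_const, integral_exp_mul_Ioi (by linarith [Real.exp_pos x]), mul_zero,
    Real.exp_zero, neg_div_neg_eq, mul_comm, mul_one_div]

end IsStieltjesWeight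

/-! ### The two weights attached to an eigenvalue -/

section
variable {α l : ℝ}

lemma isStieltjesWeight_exp_mul_kern (hα : α ∈ Ioo (0 : ℝ) 1) (hl : 0 < l) :
    IsStieltjesWeight fun x => Real.exp x * kern α l x where
  continuous := Real.continuous_exp.mul (continuous_kern hα hl)
  nonneg x := mul_nonneg (Real.exp_pos x).le (kern_nonneg hα hl x)
  integrable c hc := by
    have hk := continuous_kern hα hl
    refine (integrable_kern hα hl).mono' (Continuous.aestronglyMeasurable
      (Continuous.div (by fun_prop) (by fun_prop) fun x => by positivity))
      (Eventually.of_forall fun x => ?_)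
    have h0 := kern_nonneg hα hl x
    rw [Real.norm_of_nonneg (by positivity), div_le_iff₀ (by positivity), mul_comm]
    exact mul_le_mul_of_nonneg_left (by linarith) h0

lemma isStieltjesWeight_const_mul_kern (hα : α ∈ Ioo (0 : ℝ) 1) (hl : 0 < l) :
    IsStieltjesWeight fun x => l * kern α l x where
  continuous := continuous_const.mul (continuous_kern hα hl)
  nonneg x := mul_nonneg hl.le (kern_nonneg hα hl x)
  integrable c hc := by
    have hk := continuous_kern hα hl
    refine ((integrable_kern hα hl).const_mul (l / c)).mono' (Continuous.aestronglyMeasurable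
      (Continuous.div (by fun_prop) (by fun_prop) fun x => by positivity))
      (Eventually.of_forall fun x => ?_)
    have h0 := kern_nonneg hα hl x
    rw [Real.norm_of_nonneg (by positivity), div_mul_eq_mul_div]
    gcongr
    linarith [Real.exp_pos x]

lemma cpow_add_ne_zero (hα : α ∈ Ioo (0 : ℝ) 1) (hl : 0 < l) {z : ℂ} (hz : 0 < z.re) :
    z ^ (α : ℂ) + l ≠ 0 := by
  have hz0 : z ≠ 0 := by rintro rfl; simp at hz
  rw [cpow_def_of_ne_zero hz0, mul_comm]
  refine exp_mul_add_ne_zero hα hl ?_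
  rw [log_im]
  exact abs_arg_le_pi z

lemma integral_exp_mul_kern_div (hα : α ∈ Ioo (0 : ℝ) 1) (hl : 0 < l) {z : ℂ} (hz : 0 < z.re) :
    ∫ x : ℝ, ((Real.exp x * kern α l x : ℝ) : ℂ) / (z + Real.exp x) = 1 / (z ^ (α : ℂ) + l) := by
  rw [← integral_kern_mul_stieltjes hα hl hz]
  congr 1; ext x; push_cast; ring

/-- Follows from the Stieltjes transform of `e ^ x kern` by
`z / (z + e ^ x) = 1 - e ^ x / (z + e ^ x)` and the total mass `1 / l` of `kern`. -/
lemma integral_const_mul_kern_div (hα : α ∈ Ioo (0 : ℝ) 1) (hl : 0 < l) {z : ℂ} (hz : 0 < z.re) :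
    ∫ x : ℝ, ((l * kern α l x : ℝ) : ℂ) / (z + Real.exp x) =
      z ^ ((α : ℂ) - 1) / (z ^ (α : ℂ) + l) := by
  have hz0 : z ≠ 0 := by rintro rfl; simp at hz
  have hzx : ∀ x : ℝ, z + Real.exp x ≠ 0 := fun x h => by
    have := congrArg re h
    simp only [add_re, ofReal_re, zero_re] at this
    linarith [Real.exp_pos x]
  have hl0 : (l : ℂ) ≠ 0 := ofReal_ne_zero.2 hl.ne'
  have hne := cpow_add_ne_zero hα hl hz
  have hk : ∫ x : ℝ, (kern α l x : ℂ) = 1 / l := by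
    rw [integral_complex_ofReal, integral_kern hα hl]; push_cast; rfl
  have hi : Integrable fun x : ℝ => (kern α l x : ℂ) := (integrable_kern hα hl).ofReal
  have hi2 : Integrable fun x : ℝ => ((Real.exp x * kern α l x : ℝ) : ℂ) / (z + Real.exp x) := by
    have hkc := continuous_kern hα hl
    refine ((isStieltjesWeight_exp_mul_kern hα hl).integrable z.re hz).mono'
      (Continuous.aestronglyMeasurable (Continuous.div (by fun_prop) (by fun_prop) hzx))
      (Eventually.of_forall fun x => ?_)
    have h0 := (isStieltjesWeight_exp_mul_kern hα hl).nonneg x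
    rw [norm_div, norm_real, Real.norm_of_nonneg h0]
    gcongr
    refine le_trans ?_ (re_le_norm _)
    rw [add_re, ofReal_re]
  have e : ∀ x : ℝ, ((l * kern α l x : ℝ) : ℂ) / (z + Real.exp x) =
      l / z * ((kern α l x : ℂ) - ((Real.exp x * kern α l x : ℝ) : ℂ) / (z + Real.exp x)) := by
    intro x
    have := hzx x
    push_cast at this ⊢
    field_simp
    ring
  simp only [e]
  rw [integral_const_mul, integral_sub hi hi2, integral_exp_mul_kern_div hα hl hz, hk,
    cpow_sub _ _ hz0, cpow_one]
  field_simp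
  ring

lemma integral_exp_mul_kern_div_real (hα : α ∈ Ioo (0 : ℝ) 1) (hl : 0 < l) {c : ℝ} (hc : 0 < c) :
    ∫ x : ℝ, Real.exp x * kern α l x / (c + Real.exp x) = 1 / (c ^ α + l) := by
  have h := integral_exp_mul_kern_div hα hl (z := c) (by simpa using hc)
  rw [← ofReal_cpow hc.le] at h
  have h2 : ((∫ x : ℝ, Real.exp x * kern α l x / (c + Real.exp x) : ℝ) : ℂ) =
      ((1 / (c ^ α + l) : ℝ) : ℂ) := by
    rw [← integral_complex_ofReal]
    push_cast at h ⊢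
    exact h
  exact ofReal_injective h2

lemma integral_const_mul_kern_div_real (hα : α ∈ Ioo (0 : ℝ) 1) (hl : 0 < l) {c : ℝ}
    (hc : 0 < c) :
    ∫ x : ℝ, l * kern α l x / (c + Real.exp x) = c ^ (α - 1) / (c ^ α + l) := by
  have h := integral_const_mul_kern_div hα hl (z := c) (by simpa using hc)
  rw [← ofReal_cpow hc.le, show ((α : ℂ) - 1) = ((α - 1 : ℝ) : ℂ) by push_cast; rfl,
    ← ofReal_cpow hc.le] at h
  have h2 : ((∫ x : ℝ, l * kern α l x / (c + Real.exp x) : ℝ) : ℂ) =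
      ((c ^ (α - 1) / (c ^ α + l) : ℝ) : ℂ) := by
    rw [← integral_complex_ofReal]
    push_cast at h ⊢
    exact h
  exact ofReal_injective h2

end

/-! ### Laplace transforms: uniqueness, powers, termwise integration -/

lemma integrable_tsum_of_summable_integral_norm {X : Type*} [MeasurableSpace X] {μ : Measure X}
    {F : ℕ → X → ℂ} (hF : ∀ n, Integrable (F n) μ)
    (hm : AEStronglyMeasurable (fun x => ∑' n, F n x) μ)
    (hs : Summable fun n => ∫ x, ‖F n x‖ ∂μ) : Integrable (fun x => ∑' n, F n x) μ := by
  refine ⟨hm, ?_⟩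
  have h1 : ∫⁻ x, ‖∑' n, F n x‖ₑ ∂μ ≤ ∑' n, ∫⁻ x, ‖F n x‖ₑ ∂μ := by
    rw [← lintegral_tsum fun n => (hF n).1.enorm]
    exact lintegral_mono fun x => enorm_tsum_le_tsum_enorm
  refine h1.trans_lt ?_
  simp only [← ofReal_integral_norm_eq_lintegral_enorm (hF _)]
  rw [← ENNReal.ofReal_tsum_of_nonneg (fun n => integral_nonneg fun x => norm_nonneg _) hs]
  exact ENNReal.ofReal_lt_top

/-- Functions with the same Laplace transform on one vertical line agree, by Fourier inversion of
the difference. -/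
lemma eq_of_laplace_eq {f g : ℝ → ℂ} (hf : ContinuousOn f (Ioi 0)) (hg : ContinuousOn g (Ioi 0))
    {c : ℝ} (hfc : ∀ z : ℂ, z.re = c → LaplaceConvergent f z)
    (hgc : ∀ z : ℂ, z.re = c → LaplaceConvergent g z)
    (h : ∀ z : ℂ, z.re = c → laplace f z = laplace g z) {t : ℝ} (ht : 0 < t) : f t = g t := by
  set D : ℝ → ℂ := (Ioi (0 : ℝ)).indicator fun s => cexp (-(c : ℂ) * s) * (f s - g s) with hD
  have hDi : Integrable D := by
    rw [hD, integrable_indicator_iff measurableSet_Ioi]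
    refine ((hfc c (ofReal_re c)).sub (hgc c (ofReal_re c))).congr
      (Eventually.of_forall fun s => ?_)
    simp only [Pi.sub_apply, laplaceIntegrand]
    ring
  have hF : FourierTransform.fourier D = 0 := by
    ext w
    set z : ℂ := c + 2 * Real.pi * w * I with hz
    have hzre : z.re = c := by simp [hz]
    have h1 := h z hzre
    rw [laplace, laplace, ← sub_eq_zero, ← integral_sub (hfc z hzre) (hgc z hzre)] at h1
    rw [Real.fourier_real_eq_integral_exp_smul, Pi.zero_apply, ← h1,
      ← integral_indicator measurableSet_Ioi]
    refine integral_congr_ae (Eventually.of_forall fun s => ?_)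
    by_cases hs : s ∈ Ioi (0 : ℝ)
    · simp only [hD, indicator_of_mem hs, laplaceIntegrand, smul_eq_mul]
      rw [← mul_assoc, ← Complex.exp_add, ← mul_sub]
      congr 2
      rw [hz]
      push_cast
      ring
    · simp only [hD, indicator_of_notMem hs, smul_zero]
  have hDt : ContinuousAt D t := by
    have h1 : ContinuousAt (fun s : ℝ => cexp (-(c : ℂ) * s) * (f s - g s)) t :=
      ContinuousAt.mul (by fun_prop) ((hf.continuousAt (Ioi_mem_nhds ht)).sub
        (hg.continuousAt (Ioi_mem_nhds ht)))
    refine h1.congr ?_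
    filter_upwards [Ioi_mem_nhds ht] with s hs
    rw [hD, indicator_of_mem hs]
  have hinv := hDi.fourierInv_fourier_eq (by rw [hF]; exact integrable_zero _ _ _) hDt
  rw [hF, hD, indicator_of_mem (mem_Ioi.2 ht)] at hinv
  have h0 : FourierTransformInv.fourierInv (0 : ℝ → ℂ) t = 0 := by
    rw [Real.fourierInv_eq]; simp
  rw [h0] at hinv
  exact sub_eq_zero.1 ((mul_eq_zero.1 hinv.symm).resolve_left (exp_ne_zero _))

/-- The Laplace transform `Γ(s) z ^ (-s)` of `t ^ (s - 1)` at complex `z`, extended from the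
positive real axis by the identity theorem; holomorphy is that of the complex moment
generating function of the measure `t ^ (s - 1) dt`. -/
lemma integral_exp_mul_rpow {s : ℝ} (hs : 0 < s) {z : ℂ} (hz : 0 < z.re) :
    IntegrableOn (fun t : ℝ => cexp (-z * t) * ((t ^ (s - 1) : ℝ) : ℂ)) (Ioi 0) ∧
      ∫ t in Ioi (0 : ℝ), cexp (-z * t) * ((t ^ (s - 1) : ℝ) : ℂ) =
        Real.Gamma s * z ^ (-(s : ℂ)) := by
  have hm : Measurable fun t : ℝ => Real.toNNReal (t ^ (s - 1)) := by fun_prop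
  have hreal : ∀ b : ℝ, 0 < b → IntegrableOn (fun t : ℝ => t ^ (s - 1) * Real.exp (-b * t))
      (Ioi 0) := fun b hb => by
    simpa using integrableOn_rpow_mul_exp_neg_mul_rpow (s := s - 1) (p := 1) (by linarith)
      one_pos hb
  have hint : ∀ z : ℂ, 0 < z.re →
      IntegrableOn (fun t : ℝ => cexp (-z * t) * ((t ^ (s - 1) : ℝ) : ℂ)) (Ioi 0) := by
    intro z hz
    refine (hreal z.re hz).mono' (Measurable.aestronglyMeasurable (by fun_prop)) ?_
    filter_upwards [ae_restrict_mem measurableSet_Ioi] with t ht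
    rw [norm_mul, norm_exp, norm_real, Real.norm_of_nonneg (Real.rpow_nonneg (le_of_lt ht) _),
      re_mul_ofReal, neg_re, mul_comm]
  refine ⟨hint z hz, ?_⟩
  set μ : Measure ℝ := (volume.restrict (Ioi 0)).withDensity
    (fun t => (Real.toNNReal (t ^ (s - 1)) : ENNReal)) with hμ
  have hmgf : ∀ z : ℂ, ProbabilityTheory.complexMGF id μ (-z) =
      ∫ t in Ioi (0 : ℝ), cexp (-z * t) * ((t ^ (s - 1) : ℝ) : ℂ) := by
    intro z
    rw [ProbabilityTheory.complexMGF, hμ, integral_withDensity_eq_integral_smul hm]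
    refine setIntegral_congr_fun measurableSet_Ioi fun t ht => ?_
    simp only [NNReal.smul_def, id, real_smul]
    rw [Real.coe_toNNReal _ (Real.rpow_nonneg (le_of_lt ht) _), mul_comm]
  have hexp : Iio 0 ⊆ interior (ProbabilityTheory.integrableExpSet id μ) := by
    refine interior_maximal (fun x hx => ?_) isOpen_Iio
    rw [ProbabilityTheory.integrableExpSet, mem_ofPred_eq, hμ,
      integrable_withDensity_iff_integrable_smul hm]
    refine (hreal (-x) (by simpa using hx)).congr ?_
    filter_upwards [ae_restrict_mem measurableSet_Ioi] with t ht
    simp only [NNReal.smul_def, id, smul_eq_mul]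
    rw [Real.coe_toNNReal _ (Real.rpow_nonneg (le_of_lt ht) _), neg_neg]
  have hU : IsOpen {z : ℂ | 0 < z.re} := isOpen_lt continuous_const continuous_re
  have hA : AnalyticOnNhd ℂ (fun z => ProbabilityTheory.complexMGF id μ (-z)) {z | 0 < z.re} := by
    refine DifferentiableOn.analyticOnNhd (fun z hz => ?_) hU
    have h1 := ProbabilityTheory.analyticAt_complexMGF (X := id) (μ := μ) (z := -z)
      (hexp (by simpa using hz))
    exact (h1.differentiableAt.comp z differentiableAt_id.neg).differentiableWithinAt
  have hB : AnalyticOnNhd ℂ (fun z : ℂ => (Real.Gamma s : ℂ) * z ^ (-(s : ℂ))) {z | 0 < z.re} := by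
    refine DifferentiableOn.analyticOnNhd (fun z hz => ?_) hU
    exact ((differentiableAt_id.cpow_const (Or.inl hz)).const_mul _).differentiableWithinAt
  have hpos : ∀ b : ℝ, 0 < b → ProbabilityTheory.complexMGF id μ (-(b : ℂ)) =
      (Real.Gamma s : ℂ) * (b : ℂ) ^ (-(s : ℂ)) := by
    intro b hb
    have h1 := Real.integral_rpow_mul_exp_neg_mul_Ioi hs hb
    rw [hmgf, ← ofReal_neg, ← ofReal_neg s, ← ofReal_cpow hb.le, ← ofReal_mul, Real.rpow_neg hb.le,
      mul_comm (Real.Gamma s), ← Real.inv_rpow hb.le, ← one_div, ← h1, ← integral_complex_ofReal]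
    refine integral_congr_ae (Eventually.of_forall fun t => ?_)
    push_cast
    rw [mul_comm, neg_mul]
  have key := hA.eqOn_of_preconnected_of_frequently_eq hB
    (convex_halfSpace_re_gt 0).isPreconnected (z₀ := 1) (by simp) (by
      have ht : Tendsto (fun x : ℝ => (x : ℂ)) (𝓝[≠] 1) (𝓝[≠] 1) := by
        refine tendsto_nhdsWithin_iff.2 ⟨?_, ?_⟩
        · exact (continuous_ofReal.tendsto' 1 1 ofReal_one).mono_left nhdsWithin_le_nhds
        · filter_upwards [self_mem_nhdsWithin] with x hx
          simpa using hx
      refine ht.frequently (Eventually.frequently ?_)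
      filter_upwards [nhdsWithin_le_nhds (Ioi_mem_nhds (zero_lt_one (α := ℝ)))] with b hb
      exact hpos b hb)
  rw [← hmgf]
  exact key hz

lemma rpow_mul_exp_neg_le_Gamma {s Y : ℝ} (hs : 1 ≤ s) (hY : 0 < Y) :
    Y ^ (s - 1) * Real.exp (-Y) ≤ Real.Gamma s := by
  have hi := Real.GammaIntegral_convergent (zero_lt_one.trans_le hs)
  rw [Real.Gamma_eq_integral (zero_lt_one.trans_le hs)]
  have h1 : ∫ x in Ioi Y, Y ^ (s - 1) * Real.exp (-x) = Y ^ (s - 1) * Real.exp (-Y) := by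
    rw [integral_const_mul, integral_exp_neg_Ioi]
  rw [← h1]
  refine le_trans (setIntegral_mono_on ?_ (hi.mono_set (Ioi_subset_Ioi hY.le)) measurableSet_Ioi
    fun x hx => ?_) (setIntegral_mono_set hi ?_ (Ioi_subset_Ioi hY.le).eventuallyLE)
  · have := exp_neg_integrableOn_Ioi Y zero_lt_one
    simp only [neg_mul, one_mul] at this
    exact this.const_mul _
  · rw [mul_comm]
    have hx' : Y < x := hx
    gcongr
  · filter_upwards [ae_restrict_mem measurableSet_Ioi] with x hx
    exact mul_nonneg (Real.exp_pos _).le (Real.rpow_nonneg (le_of_lt hx) _)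

/-! ### The Mittag-Leffler kernels -/

section
variable {α β l : ℝ}

/-- The series of `E_{α,β}` converges everywhere: the Gamma function outgrows every geometric
sequence. -/
lemma summable_pow_div_Gamma (hα : 0 < α) (hβ : 0 < β) {X : ℝ} (hX : 0 ≤ X) :
    Summable fun k : ℕ => X ^ k / Real.Gamma (k * α + β) := by
  -- with `Y ^ α = 2 (X + 1)` the lower bound `Γ(s) ≥ Y ^ (s - 1) e ^ (-Y)` gives ratio `≤ 1 / 2`
  set Y : ℝ := (2 * (X + 1)) ^ α⁻¹ with hY
  have hY0 : 0 < Y := by positivity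
  have hYα : Y ^ α = 2 * (X + 1) := Real.rpow_inv_rpow (by positivity) hα.ne'
  have hG : ∀ k : ℕ, 0 < Real.Gamma (k * α + β) := fun k => Real.Gamma_pos_of_pos (by positivity)
  refine Summable.of_norm_bounded_eventually_nat
    (g := fun k => (Real.exp Y * Y ^ (1 - β)) * (1 / 2) ^ k)
    ((summable_geometric_of_lt_one (by norm_num) (by norm_num)).mul_left _) ?_
  obtain ⟨N, hN⟩ := exists_nat_ge (1 / α)
  filter_upwards [eventually_ge_atTop N] with k hk
  have hk1 : 1 ≤ k * α + β := by
    have : 1 / α ≤ k := hN.trans (by exact_mod_cast hk)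
    rw [div_le_iff₀ hα] at this
    linarith
  have h1 := rpow_mul_exp_neg_le_Gamma hk1 hY0
  have e1 : Y ^ ((k : ℝ) * α + β - 1) = (2 * (X + 1)) ^ k * Y ^ (β - 1) := by
    rw [add_sub_assoc, Real.rpow_add hY0, mul_comm (k : ℝ), Real.rpow_mul hY0.le, hYα,
      Real.rpow_natCast]
  rw [Real.norm_of_nonneg (div_nonneg (by positivity) (hG k).le), div_le_iff₀ (hG k)]
  calc X ^ k ≤ (X + 1) ^ k := by gcongr; linarith
    _ = (Real.exp Y * Y ^ (1 - β)) * (1 / 2) ^ k *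
          (Y ^ ((k : ℝ) * α + β - 1) * Real.exp (-Y)) := by
        rw [e1, mul_pow, Real.exp_neg, show (1 - β) = -(β - 1) by ring, Real.rpow_neg hY0.le]
        have := (Real.rpow_pos_of_pos hY0 (β - 1)).ne'
        have := (Real.exp_pos Y).ne'
        field_simp
        rw [← mul_pow]
        norm_num
    _ ≤ _ := by gcongr

lemma norm_mittagLeffler_term (hα : 0 < α) (hβ : 0 < β) (z : ℂ) (k : ℕ) :
    ‖z ^ k / (Real.Gamma (k * α + β) : ℂ)‖ = ‖z‖ ^ k / Real.Gamma (k * α + β) := by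
  rw [norm_div, norm_pow, norm_real,
    Real.norm_of_nonneg (Real.Gamma_pos_of_pos (by positivity)).le]

lemma continuous_mittagLeffler (hα : 0 < α) (hβ : 0 < β) : Continuous (mittagLeffler α β) := by
  refine continuous_iff_continuousAt.2 fun z => ?_
  have h : ContinuousOn (mittagLeffler α β) (Metric.closedBall 0 (‖z‖ + 1)) := by
    refine continuousOn_tsum (fun k => by fun_prop)
      (summable_pow_div_Gamma hα hβ (X := ‖z‖ + 1) (by positivity)) fun k w hw => ?_
    rw [norm_mittagLeffler_term hα hβ]
    have := Real.Gamma_pos_of_pos (s := k * α + β) (by positivity)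
    have hw' : ‖w‖ ≤ ‖z‖ + 1 := by simpa using hw
    gcongr
  exact h.continuousAt (Metric.closedBall_mem_nhds_of_mem (by simp))

/-- The Mittag-Leffler kernel `t ^ (β - 1) E_{α,β}(-l t ^ α)`. -/
def mlKernel (α β l t : ℝ) : ℂ :=
  ((t ^ (β - 1) : ℝ) : ℂ) * mittagLeffler α β ((-(l * t ^ α) : ℝ) : ℂ)

lemma continuousOn_mlKernel (hα : 0 < α) (hβ : 0 < β) :
    ContinuousOn (mlKernel α β l) (Ioi 0) := by
  refine ContinuousOn.mul ?_ ((continuous_mittagLeffler hα hβ).comp_continuousOn ?_)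
  · exact continuous_ofReal.comp_continuousOn
      (continuousOn_id.rpow_const fun x hx => Or.inl (ne_of_gt hx))
  · exact continuous_ofReal.comp_continuousOn
      ((continuousOn_id.rpow_const fun x hx => Or.inl (ne_of_gt hx)).const_mul l).neg

/-- Termwise Laplace transform of the Mittag-Leffler kernel, for `Re z` so large that the
resulting geometric series converges. -/
lemma laplace_mlKernel (hα : 0 < α) (hβ : 0 < β) (hl : 0 < l) {z : ℂ} (hz : 0 < z.re)
    (hlz : l < z.re ^ α) :
    LaplaceConvergent (mlKernel α β l) z ∧
      laplace (mlKernel α β l) z = z ^ ((α : ℂ) - β) / (z ^ (α : ℂ) + l) := by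
  have hz0 : z ≠ 0 := by rintro rfl; simp at hz
  set s : ℕ → ℝ := fun k => k * α + β with hs
  have hs0 : ∀ k, 0 < s k := fun k => by positivity
  have hG : ∀ k, 0 < Real.Gamma (s k) := fun k => Real.Gamma_pos_of_pos (hs0 k)
  set F : ℕ → ℝ → ℂ := fun k t =>
    ((-(l : ℂ)) ^ k / Real.Gamma (s k)) * (cexp (-z * t) * ((t ^ (s k - 1) : ℝ) : ℂ)) with hF
  have hsum : ∀ t ∈ Ioi (0 : ℝ), ∑' k, F k t = laplaceIntegrand (mlKernel α β l) z t := by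
    intro t ht
    have ht' : 0 < t := ht
    rw [laplaceIntegrand, mlKernel, mittagLeffler, ← tsum_mul_left, ← tsum_mul_left]
    refine tsum_congr fun k => ?_
    have : t ^ (s k - 1) = t ^ (β - 1) * (t ^ α) ^ k := by
      rw [hs, ← Real.rpow_natCast (t ^ α), ← Real.rpow_mul ht'.le, ← Real.rpow_add ht']
      congr 1; ring
    rw [hF]
    simp only [this]
    push_cast
    rw [← mul_neg_one, ← mul_neg_one (l * (t ^ α : ℝ) : ℂ)]
    ring
  have hint : ∀ k, IntegrableOn (F k) (Ioi 0) := fun k =>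
    (integral_exp_mul_rpow (hs0 k) hz).1.const_mul _
  have hval : ∀ k, ∫ t in Ioi (0 : ℝ), F k t =
      z ^ (-(β : ℂ)) * (-(l : ℂ) * z ^ (-(α : ℂ))) ^ k := by
    intro k
    have hG' : (Real.Gamma (s k) : ℂ) ≠ 0 := ofReal_ne_zero.2 (hG k).ne'
    rw [hF, integral_const_mul, (integral_exp_mul_rpow (hs0 k) hz).2, ← mul_assoc,
      div_mul_cancel₀ _ hG', hs, mul_pow, ← cpow_nat_mul,
      show (-(((k * α + β : ℝ)) : ℂ)) = -(β : ℂ) + k * (-(α : ℂ)) by push_cast; ring,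
      cpow_add _ _ hz0]
    ring
  have hnorm : ∀ k, ∫ t in Ioi (0 : ℝ), ‖F k t‖ = z.re ^ (-β) * (l * z.re ^ (-α)) ^ k := by
    intro k
    have e : ∀ t ∈ Ioi (0 : ℝ), ‖F k t‖ =
        (l ^ k / Real.Gamma (s k)) * (t ^ (s k - 1) * Real.exp (-(z.re * t))) := by
      intro t ht
      rw [hF, norm_mul, norm_mul, norm_div, norm_pow, norm_neg, norm_real, norm_real, norm_real,
        norm_exp, Real.norm_of_nonneg hl.le, Real.norm_of_nonneg (hG k).le,
        Real.norm_of_nonneg (Real.rpow_nonneg (le_of_lt ht) _), re_mul_ofReal, neg_re, neg_mul,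
        mul_comm (Real.exp _)]
    rw [setIntegral_congr_fun measurableSet_Ioi e, integral_const_mul,
      Real.integral_rpow_mul_exp_neg_mul_Ioi (hs0 k) hz, one_div, Real.inv_rpow hz.le,
      ← Real.rpow_neg hz.le, mul_comm (z.re ^ _), ← mul_assoc, div_mul_cancel₀ _ (hG k).ne', hs,
      mul_pow, ← Real.rpow_natCast (z.re ^ (-α)), ← Real.rpow_mul hz.le,
      show (-(k * α + β : ℝ)) = -β + -α * k by ring, Real.rpow_add hz]
    ring
  have hratio : l * z.re ^ (-α) < 1 := by
    rw [Real.rpow_neg hz.le, ← div_eq_mul_inv, div_lt_one (by positivity)]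
    exact hlz
  have hsn : Summable fun k => ∫ t in Ioi (0 : ℝ), ‖F k t‖ := by
    simp only [hnorm]
    exact (summable_geometric_of_lt_one (by positivity) hratio).mul_left _
  have hae : (fun t => ∑' k, F k t) =ᵐ[volume.restrict (Ioi 0)]
      laplaceIntegrand (mlKernel α β l) z := by
    filter_upwards [ae_restrict_mem measurableSet_Ioi] with t ht using hsum t ht
  have hmeas : AEStronglyMeasurable (laplaceIntegrand (mlKernel α β l) z)
      (volume.restrict (Ioi 0)) :=
    ContinuousOn.aestronglyMeasurable
      (ContinuousOn.mul (by fun_prop) (continuousOn_mlKernel hα hβ)) measurableSet_Ioi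
  refine ⟨(integrable_tsum_of_summable_integral_norm hint (hmeas.congr hae.symm) hsn).congr hae,
    ?_⟩
  have h1 := hasSum_integral_of_summable_integral_norm hint hsn
  rw [integral_congr_ae hae] at h1
  simp only [hval] at h1
  have hzα : z ^ (α : ℂ) ≠ 0 := by simp [cpow_eq_zero_iff, hz0]
  have hlt : ‖-(l : ℂ) * z ^ (-(α : ℂ))‖ < 1 := by
    refine lt_of_le_of_lt ?_ hratio
    rw [norm_mul, norm_neg, norm_real, Real.norm_of_nonneg hl.le, ← ofReal_neg,
      norm_cpow_real]
    exact mul_le_mul_of_nonneg_left (Real.rpow_le_rpow_of_nonpos hz (re_le_norm z)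
      (by linarith)) hl.le
  have h2 := (hasSum_geometric_of_norm_lt_one hlt).mul_left (z ^ (-(β : ℂ)))
  rw [laplace, h1.unique h2, cpow_sub _ _ hz0, cpow_neg, cpow_neg]
  have hzβ : z ^ (β : ℂ) ≠ 0 := by simp [cpow_eq_zero_iff, hz0]
  rw [show 1 - -(l : ℂ) * (z ^ (α : ℂ))⁻¹ = (z ^ (α : ℂ) + l) / z ^ (α : ℂ) by field_simp; ring,
    inv_div]
  field_simp

end

section
variable {α l : ℝ}

/-- A weight with the Stieltjes transform `z ^ (α - β) / (z ^ α + l)` represents the Mittag-Leffler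
kernel. -/
lemma mlKernel_eq_lapExp {β : ℝ} (hα : 0 < α) (hβ : 0 < β) (hl : 0 < l) {p : ℝ → ℝ}
    (hp : IsStieltjesWeight p) (h : ∀ z : ℂ, 0 < z.re → ∫ x : ℝ, (p x : ℂ) / (z + Real.exp x) =
      z ^ ((α : ℂ) - β) / (z ^ (α : ℂ) + l)) {t : ℝ} (ht : 0 < t) :
    mlKernel α β l t = lapExp p t := by
  set c : ℝ := (l + 1) ^ α⁻¹ with hc
  have hc0 : 0 < c := by positivity
  have hcα : c ^ α = l + 1 := Real.rpow_inv_rpow (by positivity) hα.ne'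
  have hML : ∀ z : ℂ, z.re = c → 0 < z.re ∧ l < z.re ^ α := fun z hz => by
    rw [hz, hcα]; exact ⟨hc0, by linarith⟩
  refine eq_of_laplace_eq (f := mlKernel α β l) (g := fun t => lapExp p t) (c := c)
    (continuousOn_mlKernel hα hβ) ?_
    (fun z hz => (laplace_mlKernel hα hβ hl (hML z hz).1 (hML z hz).2).1)
    (fun z hz => hp.laplaceConvergent_lapExp (hML z hz).1)
    (fun z hz => ?_) ht
  · exact hp.differentiableOn_lapExp.continuousOn.comp continuous_ofReal.continuousOn
      fun t ht => by simpa using ht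
  · rw [(laplace_mlKernel hα hβ hl (hML z hz).1 (hML z hz).2).2,
      hp.laplace_lapExp (hML z hz).1, h z (hML z hz).1]

/-- `E_{α,1}(-l t ^ α)` is completely monotone in `t`. -/
lemma mittagLeffler_one_eq_lapExp (hα : α ∈ Ioo (0 : ℝ) 1) (hl : 0 < l) {t : ℝ} (ht : 0 < t) :
    mittagLeffler α 1 ((-(l * t ^ α) : ℝ) : ℂ) = lapExp (fun x => l * kern α l x) t := by
  rw [← mlKernel_eq_lapExp hα.1 one_pos hl (isStieltjesWeight_const_mul_kern hα hl)
    (fun z hz => by rw [integral_const_mul_kern_div hα hl hz, ofReal_one]) ht]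
  simp [mlKernel]

/-- `t ^ (α - 1) E_{α,α}(-l t ^ α)` is completely monotone in `t`. -/
lemma mlKernel_self_eq_lapExp (hα : α ∈ Ioo (0 : ℝ) 1) (hl : 0 < l) {t : ℝ} (ht : 0 < t) :
    mlKernel α α l t = lapExp (fun x => Real.exp x * kern α l x) t :=
  mlKernel_eq_lapExp hα.1 hα.1 hl (isStieltjesWeight_exp_mul_kern hα hl)
    (fun z hz => by rw [integral_exp_mul_kern_div hα hl hz, sub_self, cpow_zero]) ht

end

/-! ### Series of completely monotone functions -/

section
variable {c lam : ℕ → ℝ} {p : ℕ → ℝ → ℝ} {B : ℝ → ℝ}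

lemma summable_bound (hc : Summable fun n => |c n| / lam n) (b σ : ℝ) :
    Summable fun n => |c n| * (b * (B σ / lam n)) :=
  (hc.mul_right (b * B σ)).congr fun n => by ring

lemma norm_coeff_mul_lapExp_le (hp : ∀ n, IsStieltjesWeight (p n))
    (hB : ∀ n σ, 0 < σ → ∫ x, p n x / (σ + Real.exp x) ≤ B σ / lam n) {σ : ℝ} (hσ : 0 < σ)
    {τ : ℂ} (hτ : σ ≤ τ.re) (n : ℕ) :
    ‖(c n : ℂ) * lapExp (p n) τ‖ ≤ |c n| * (1 / σ * (B (1 / σ) / lam n)) := by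
  rw [norm_mul, norm_real, Real.norm_eq_abs]
  have h1 := hB n (1 / σ) (by positivity)
  refine mul_le_mul_of_nonneg_left (((hp n).norm_lapExp_le hσ hτ).trans ?_) (abs_nonneg _)
  gcongr

lemma summable_coeff_mul_lapExp (hc : Summable fun n => |c n| / lam n)
    (hp : ∀ n, IsStieltjesWeight (p n))
    (hB : ∀ n σ, 0 < σ → ∫ x, p n x / (σ + Real.exp x) ≤ B σ / lam n) {t : ℝ} (ht : 0 < t) :
    Summable fun n => (c n : ℂ) * lapExp (p n) t :=
  Summable.of_norm_bounded (summable_bound hc (1 / t) (1 / t))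
    (norm_coeff_mul_lapExp_le hp hB ht (by simp))

/-- The series converges uniformly on each half-plane `Re τ > σ > 0`, so its sum is holomorphic
there and real-analytic on the positive half-line. -/
lemma analyticOnNhd_tsum_lapExp (hc : Summable fun n => |c n| / lam n)
    (hp : ∀ n, IsStieltjesWeight (p n))
    (hB : ∀ n σ, 0 < σ → ∫ x, p n x / (σ + Real.exp x) ≤ B σ / lam n) :
    AnalyticOnNhd ℝ (fun t : ℝ => ∑' n, (c n : ℂ) * lapExp (p n) t) (Ioi 0) := by
  intro t ht
  have ht' : 0 < t := ht
  have hU : IsOpen {τ : ℂ | t / 2 < τ.re} := isOpen_lt continuous_const continuous_re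
  have h1 : DifferentiableOn ℂ (fun τ => ∑' n, (c n : ℂ) * lapExp (p n) τ)
      {τ : ℂ | t / 2 < τ.re} :=
    differentiableOn_tsum_of_summable_norm (summable_bound hc (1 / (t / 2)) (1 / (t / 2)))
      (fun n => ((hp n).differentiableOn_lapExp.const_mul _).mono fun τ hτ =>
        (half_pos ht').trans hτ) hU
      fun n τ hτ => norm_coeff_mul_lapExp_le hp hB (half_pos ht') (le_of_lt hτ) n
  have h2 : AnalyticAt ℂ (fun τ => ∑' n, (c n : ℂ) * lapExp (p n) τ) (t : ℂ) :=
    h1.analyticAt (hU.mem_nhds (by simpa using ht'))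
  exact (h2.restrictScalars (𝕜 := ℝ)).comp_of_eq (ofRealCLM.analyticAt t) rfl

lemma laplace_tsum_lapExp (hc : Summable fun n => |c n| / lam n)
    (hp : ∀ n, IsStieltjesWeight (p n))
    (hB : ∀ n σ, 0 < σ → ∫ x, p n x / (σ + Real.exp x) ≤ B σ / lam n) {z : ℂ} (hz : 0 < z.re) :
    LaplaceConvergent (fun t : ℝ => ∑' n, (c n : ℂ) * lapExp (p n) t) z ∧
      HasSum (fun n => (c n : ℂ) * ∫ x : ℝ, (p n x : ℂ) / (z + Real.exp x))
        (laplace (fun t : ℝ => ∑' n, (c n : ℂ) * lapExp (p n) t) z) := by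
  set F : ℕ → ℝ → ℂ := fun n t => (c n : ℂ) * laplaceIntegrand (fun t => lapExp (p n) t) z t with hF
  have hsum : (fun t => ∑' n, F n t) =
      laplaceIntegrand (fun t : ℝ => ∑' n, (c n : ℂ) * lapExp (p n) t) z := by
    ext t
    simp only [hF, laplaceIntegrand, ← tsum_mul_left]
    exact tsum_congr fun n => by ring
  have hint : ∀ n, IntegrableOn (F n) (Ioi 0) := fun n =>
    ((hp n).laplaceConvergent_lapExp hz).const_mul _
  have hnorm : ∀ n, ∫ t in Ioi (0 : ℝ), ‖F n t‖ ≤ |c n| * (1 * (B z.re / lam n)) := by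
    intro n
    simp only [hF, norm_mul, norm_real, Real.norm_eq_abs]
    rw [integral_const_mul, one_mul]
    exact mul_le_mul_of_nonneg_left (((hp n).integral_norm_laplaceIntegrand_le hz).trans
      (hB n z.re hz)) (abs_nonneg _)
  have hsn : Summable fun n => ∫ t in Ioi (0 : ℝ), ‖F n t‖ :=
    Summable.of_nonneg_of_le (fun n => integral_nonneg fun t => norm_nonneg _) hnorm
      (summable_bound hc 1 z.re)
  have hm : AEStronglyMeasurable (fun t => ∑' n, F n t) (volume.restrict (Ioi 0)) := by
    rw [hsum]
    exact ContinuousOn.aestronglyMeasurable (ContinuousOn.mul (by fun_prop)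
      (analyticOnNhd_tsum_lapExp hc hp hB).continuousOn) measurableSet_Ioi
  constructor
  · rw [LaplaceConvergent, ← hsum]
    exact integrable_tsum_of_summable_integral_norm hint hm hsn
  · have h1 := hasSum_integral_of_summable_integral_norm hint hsn
    rw [hsum] at h1
    refine h1.congr_fun fun n => ?_
    rw [hF, integral_const_mul, ← (hp n).laplace_lapExp hz, laplace]

/-- The conclusions for a series `h = ∑ c_n T_n` of completely monotone functions `T_n` whose
Stieltjes transforms are bounded by a multiple of `1 / λ_n`. -/
lemma completelyMonotone_series (hc : Summable fun n => |c n| / lam n)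
    (hp : ∀ n, IsStieltjesWeight (p n))
    (hB : ∀ n σ, 0 < σ → ∫ x, p n x / (σ + Real.exp x) ≤ B σ / lam n)
    {T : ℕ → ℝ → ℂ} (hT : ∀ n t, 0 < t → T n t = c n * lapExp (p n) t) :
    (∀ t, 0 < t → Summable fun n => T n t) ∧
      AnalyticOnNhd ℝ (fun t => ∑' n, T n t) (Ioi 0) ∧
      ∀ z : ℂ, 0 < z.re → LaplaceConvergent (fun t => ∑' n, T n t) z ∧
        HasSum (fun n => (c n : ℂ) * ∫ x : ℝ, (p n x : ℂ) / (z + Real.exp x))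
          (laplace (fun t => ∑' n, T n t) z) := by
  have hE : EqOn (fun t : ℝ => ∑' n, (c n : ℂ) * lapExp (p n) t) (fun t => ∑' n, T n t) (Ioi 0) :=
    fun t ht => tsum_congr fun n => (hT n t ht).symm
  refine ⟨fun t ht => ?_, (analyticOnNhd_tsum_lapExp hc hp hB).congr isOpen_Ioi hE,
    fun z hz => ?_⟩
  · simp only [hT _ t ht]
    exact summable_coeff_mul_lapExp hc hp hB ht
  · have hI : EqOn (laplaceIntegrand (fun t : ℝ => ∑' n, (c n : ℂ) * lapExp (p n) t) z)
        (laplaceIntegrand (fun t => ∑' n, T n t) z) (Ioi 0) := fun t ht => by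
      have := hE ht
      simp only at this
      simp only [laplaceIntegrand, this]
    obtain ⟨h1, h2⟩ := laplace_tsum_lapExp hc hp hB hz
    refine ⟨IntegrableOn.congr_fun h1 hI measurableSet_Ioi, ?_⟩
    rw [laplace, setIntegral_congr_fun measurableSet_Ioi hI] at h2
    exact h2

end

end Subdiffusion

end

theorem proposition2p2 (α : ℝ) (hα : α ∈ Set.Ioo (0 : ℝ) 1) (a q : ℝ → ℝ)
    (haq : Subdiffusion.IsAdmissible a q) (lam : ℕ → ℝ) (φ : ℕ → ℝ → ℝ)
    (hφ : Subdiffusion.IsEigenSystem a q lam φ) (u₀ f : ℝ → ℝ)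
    (hu₀ : MeasureTheory.MemLp u₀ 2 Subdiffusion.unitMeasure)
    (hf : MeasureTheory.MemLp f 2 Subdiffusion.unitMeasure) :
    -- both series converge at every `t > 0`
    (∀ t : ℝ, 0 < t → Summable (fun n => Subdiffusion.h₁Term α lam φ u₀ f n t) ∧
      Summable (fun n => Subdiffusion.h₂Term α lam φ n t)) ∧
    -- (i) their sums are real-analytic on `(0, ∞)`
    (AnalyticOnNhd ℝ (Subdiffusion.h₁ α lam φ u₀ f) (Set.Ioi 0) ∧
      AnalyticOnNhd ℝ (Subdiffusion.h₂ α lam φ) (Set.Ioi 0)) ∧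
    -- (ii) the Laplace transforms exist and are given by convergent series
    (∀ z : ℂ, 0 < z.re →
      (Subdiffusion.LaplaceConvergent (Subdiffusion.h₁ α lam φ u₀ f) z ∧
        HasSum (fun n => (Subdiffusion.rho lam φ u₀ f n : ℂ) * z ^ ((α : ℂ) - 1) /
            (z ^ (α : ℂ) + (lam n : ℂ)))
          (Subdiffusion.laplace (Subdiffusion.h₁ α lam φ u₀ f) z)) ∧
      (Subdiffusion.LaplaceConvergent (Subdiffusion.h₂ α lam φ) z ∧
        HasSum (fun n => ((φ n 0) ^ 2 : ℂ) / (z ^ (α : ℂ) + (lam n : ℂ)))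
          (Subdiffusion.laplace (Subdiffusion.h₂ α lam φ) z))) := by
  have hl := hφ.lam_pos haq
  obtain ⟨s₁, a₁, l₁⟩ := Subdiffusion.completelyMonotone_series (lam := lam)
    (c := Subdiffusion.rho lam φ u₀ f) (B := fun σ => σ ^ (α - 1))
    (hφ.summable_abs_rho_div haq hu₀ hf)
    (fun n => Subdiffusion.isStieltjesWeight_const_mul_kern hα (hl n))
    (fun n σ hσ => by
      rw [Subdiffusion.integral_const_mul_kern_div_real hα (hl n) hσ]
      have := hl n
      gcongr
      linarith [Real.rpow_pos_of_pos hσ α])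
    (T := Subdiffusion.h₁Term α lam φ u₀ f)
    (fun n t ht => by
      rw [Subdiffusion.h₁Term, Subdiffusion.mittagLeffler_one_eq_lapExp hα (hl n) ht])
  obtain ⟨s₂, a₂, l₂⟩ := Subdiffusion.completelyMonotone_series (lam := lam)
    (c := fun n => φ n 0 ^ 2) (B := fun _ => 1)
    (by simpa only [abs_sq] using hφ.summable_sq_div haq)
    (fun n => Subdiffusion.isStieltjesWeight_exp_mul_kern hα (hl n))
    (fun n σ hσ => by
      rw [Subdiffusion.integral_exp_mul_kern_div_real hα (hl n) hσ]
      have := hl n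
      gcongr
      linarith [Real.rpow_pos_of_pos hσ α])
    (T := Subdiffusion.h₂Term α lam φ)
    (fun n t ht => by
      rw [← Subdiffusion.mlKernel_self_eq_lapExp hα (hl n) ht, Subdiffusion.mlKernel,
        Subdiffusion.h₂Term, Complex.ofReal_mul, mul_assoc])
  refine ⟨fun t ht => ⟨s₁ t ht, s₂ t ht⟩, ⟨a₁, a₂⟩, fun z hz => ⟨⟨(l₁ z hz).1, ?_⟩,
    ⟨(l₂ z hz).1, ?_⟩⟩⟩
  · refine (l₁ z hz).2.congr_fun fun n => ?_
    rw [Subdiffusion.integral_const_mul_kern_div hα (hl n) hz, mul_div_assoc]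
  · refine (l₂ z hz).2.congr_fun fun n => ?_
    rw [Subdiffusion.integral_exp_mul_kern_div hα (hl n) hz, mul_one_div, Complex.ofReal_pow]
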